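/- Fix an integer $m\ge 1$, real numbers $\delta\neq\delta'$ with $\delta,\delta'>-m$, and $\varepsilon\in(0,1)$. For $n\ge 2$ and an integer $\tau\in[0,n]$ let $\mathbb{Q}_{n,\tau}$ be the law of the random multigraph $G_n$ on a fixed vertex set $V$ with $|V|=n$ generated as follows. $G_2$ consists of two distinct vertices of $V$ chosen uniformly at random, joined by $m$ parallel edges. For $3\le t\le n$, a new vertex $v_t$ is chosen uniformly at random among the vertices of $V$ not in $G_{t-1}$, and $m$ edges are added one after the other from $v_t$ to vertices of $G_{t-1}$, each edge going to a vertex $v$ of $G_{t-1}$ with conditional probability, given the past, proportional to $\deg(v)+\delta_t$; here $\deg(v)$ is the degree in the current graph (including the edges already added from $v_t$), $\delta_t=\delta$ for $t\le\tau$ and $\delta_t=\delta'$ for $t>\tau$. Only the final undirected multigraph $G_n$ is observed, not the arrival times of its vertices and edges. Then no estimator based on $G_n$ localizes the changepoint within $o(\sqrt n)$ with non-vanishing probability uniformly over $\tau_n\in[\varepsilon n,n]$. That is, for all estimators $\widehat\tau_n=\widehat\tau_n(G_n)\in\mathbb{R}$ and every sequence $r_n=o(\sqrt n)$, $$\min_{\tau\in[\varepsilon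 n,n]\cap\mathbb{Z}}\ \mathbb{Q}_{n,\tau}\big[\,|\widehat\tau_n(G_n)-\tau|\le r_n\,\big]\ \longrightarrow\ 0\qquad (n\to\infty).$$ -/

import Mathlib

open Filter Asymptotics

namespace PrefAttach

/-- A finite undirected multigraph whose vertices are taken from `V`. Parallel edges are recorded by
multiplicity only; in particular neither the edges nor the vertices carry arrival times. -/
@[ext]
structure PAMultigraph (V : Type*) where
  /-- the set of vertices present in the graph -/
  verts : Finset V
  /-- the multiset of edges -/
  edges : Multiset (Sym2 V)

namespace PAMultigraph

instance (V : Type*) : MeasurableSpace (PAMultigraph V) := ⊤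

variable {V : Type*} [DecidableEq V]

/-- The degree of `v`, counting parallel edges with multiplicity. (The model has no loops.) -/
def deg (G : PAMultigraph V) (v : V) : ℕ :=
  G.edges.countP (fun e => v ∈ e)

/-- The graph `G` with one additional edge between `v` and `u`; the vertex set is unchanged. -/
def addEdge (G : PAMultigraph V) (v u : V) : PAMultigraph V :=
  ⟨G.verts, s(v, u) ::ₘ G.edges⟩

/-- The graph `G` with an additional isolated vertex `v`. -/
def addVertex (G : PAMultigraph V) (v : V) : PAMultigraph V :=
  ⟨insert v G.verts, G.edges⟩

end PAMultigraph

open Classical in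
/-- The distribution on `s` that gives `a ∈ s` the probability `w a / ∑ b ∈ s, w b`, for a weight `w`
that is nonnegative on `s` and not identically zero on `s` (and, so that the definition is total, the
point mass at `d` if there is no `a ∈ s` with `w a > 0`). -/
noncomputable def weightedOn {α : Type*} (s : Finset α) (w : α → ℝ) (d : α) : PMF α :=
  if h : ∃ a ∈ s, 0 < w a then
    PMF.normalize (fun a => if a ∈ s then ENNReal.ofReal (w a) else 0)
      (by
        obtain ⟨a, ha, hw⟩ := h
        intro h0
        have h1 := ENNReal.tsum_eq_zero.mp h0 a
        rw [if_pos ha, ENNReal.ofReal_eq_zero] at h1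
        exact absurd hw (not_lt.mpr h1))
      (by
        rw [tsum_eq_sum (s := s) (fun a ha => if_neg ha)]
        refine ENNReal.sum_ne_top.mpr (fun a ha => ?_)
        rw [if_pos ha]
        exact ENNReal.ofReal_ne_top)
  else PMF.pure d

section Model

variable {V : Type*} [DecidableEq V]

/-- Adding `i` edges one after the other from the new vertex `v` to the set `S` of old vertices. Each
edge goes to `u ∈ S` with conditional probability
`(deg u + δ) / ∑ w ∈ S, (deg w + δ)`, with the degrees in the current graph, which includes the edges
already added from `v`. -/
noncomputable def attachEdges (δ : ℝ) (S : Finset V) (v : V) :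
    ℕ → PAMultigraph V → PMF (PAMultigraph V)
  | 0, G => PMF.pure G
  | i + 1, G => (attachEdges δ S v i G).bind fun G' =>
      (weightedOn S (fun u => (G'.deg u : ℝ) + δ) v).map fun u => G'.addEdge v u

variable [Fintype V]

/-- The law of the initial graph: two distinct vertices, chosen uniformly at random and joined by `m`
parallel edges. (If there are not two distinct vertices, it is the empty graph, for totality.) -/
noncomputable def initialLaw (V : Type*) [DecidableEq V] [Fintype V] (m : ℕ) :
    PMF (PAMultigraph V) :=
  if h : ((Finset.univ : Finset V).offDiag).Nonempty then
    (PMF.uniformOfFinset _ h).map fun p =>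
      ⟨{p.1, p.2}, Multiset.replicate m s(p.1, p.2)⟩
  else PMF.pure ⟨∅, 0⟩

/-- One time step: a new vertex is chosen uniformly at random among the vertices not yet present, and
`m` edges are added from it to the vertices of `G`. (If all vertices are already present, the graph
stays the same, for totality.) -/
noncomputable def growthStep (m : ℕ) (δ : ℝ) (G : PAMultigraph V) : PMF (PAMultigraph V) :=
  if h : (Finset.univ \ G.verts).Nonempty then
    (PMF.uniformOfFinset _ h).bind fun v => attachEdges δ G.verts v m (G.addVertex v)
  else PMF.pure G

/-- The law of the graph at time `t`, with initial graph at time `2` and with shift `δ t` used at time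
`t ≥ 3`. (Times `0` and `1` are not part of the model; the initial law is put there for totality.) -/
noncomputable def graphLaw (V : Type*) [DecidableEq V] [Fintype V] (m : ℕ) (δ : ℕ → ℝ) :
    ℕ → PMF (PAMultigraph V)
  | t + 3 => (graphLaw V m δ (t + 2)).bind (growthStep m (δ (t + 3)))
  | _ => initialLaw V m

end Model

/-- The law of the final snapshot at time `n`, on a vertex set of size `n`, of the preferential
attachment model with shifts `δ t`. -/
noncomputable def snapshotLaw (m n : ℕ) (δ : ℕ → ℝ) : PMF (PAMultigraph (Fin n)) :=
  graphLaw (Fin n) m δ n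

/-- The law of the final snapshot when the shift changes from `δ` to `δ'` after time `τ`. -/
noncomputable def changepointLaw (m n : ℕ) (δ δ' : ℝ) (τ : ℕ) : PMF (PAMultigraph (Fin n)) :=
  snapshotLaw m n fun t => if t ≤ τ then δ else δ'

end PrefAttach

/-!
The change from `δ` to `δ'` can be hidden in the last `o(√n)` steps. It suffices that moving a
late changepoint by one step changes the probability of every event by `O(1 / √n)`
(`changepointLaw_pred_le`): then the `N + 1` laws with changepoints `n - i d`, where `d > 2 r` is
still `o(√n)`, are asymptotically indistinguishable, while the events that the estimator is within
`r` of `n - i d` are disjoint, so that one of them has probability at most `1 / (N + 1)` up to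
`o(1)`.

Since growth is a Markov chain on graphs without arrival times, the one-step claim concerns the
graph right after the step whose shift is changed. Let `φ` be the relative change of the
likelihood, a function of the graph and of the targets of its last vertex (`score`). It is to be
shown that `E[φ f] = O(1 / √k)` for a function `f` of the graph with `|f| ≤ 1`, when `k` steps
have been made since a reference graph with `s ≥ c k` vertices. The vertices that arrived after
the reference time span a graph whose connected components are called blocks; the order of
arrival of vertices in different blocks leaves no trace, because the weight of a list of targets
does not depend on its order (`wt_perm`, `stepMean_swap`). Hence the last vertex looks like the
last vertex of a size-biased block. This is the exchange identity `pow_stepOp_blockSum`, which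
reads `k E[F(new block)] = E[∑_B |B| F(B)]` and is proved by induction on `k`, exchanging the
last two vertices. It has three uses.

* The expected size of the newest block satisfies a linear recursion, because a step hits a
  block with probability `O(|B| / s)`, and `E[∑_B |B|²]` is `k` times an expected size. Hence it
  is at most `2` (`pow_stepOp_newMean_size_le`).
* With `Y = ∑_B |B| φ(B)`, one has `k E[φ f] = E[Y f] ≤ E[Y²] / √k + √k`.
* Finally `E[Y²] = k E[φ Y]`. The score `φ` of the last vertex is centred given the past, so
  only the change of `Y` in the last step matters. It is bounded by the size of the new block
  and by the effect of the new edges on the scores of the other blocks, which has mean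
  `O(k/s)`. Hence `E[Y²] = O(k)` (`pow_stepOp_scoreSum_sq_le`).

Means are finite sums throughout; they are related to the laws of the model by
`pmean_graphLaw_add`.
-/

namespace PrefAttach

/-! ### Lists of targets and their weights -/

section Lists

variable {V : Type*}

lemma cons_injective : Function.Injective fun p : V × List V => p.1 :: p.2 := fun _ _ h =>
  Prod.ext (List.cons.inj h).1 (List.cons.inj h).2

/-- The lists of length `i` with entries in `S`. -/
def lists (S : Finset V) : ℕ → Finset (List V)
  | 0 => {[]}
  | i + 1 => (S ×ˢ lists S i).map ⟨_, cons_injective⟩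

lemma sum_lists_succ {M : Type*} [AddCommMonoid M] (S : Finset V) (i : ℕ) (g : List V → M) :
    ∑ l ∈ lists S (i + 1), g l = ∑ l ∈ lists S i, ∑ u ∈ S, g (u :: l) := by
  rw [lists, Finset.sum_map, Finset.sum_product_right]
  rfl

lemma mem_lists {S : Finset V} {i : ℕ} {l : List V} :
    l ∈ lists S i ↔ l.length = i ∧ ∀ u ∈ l, u ∈ S := by
  induction i generalizing l with
  | zero =>
    simp only [lists, Finset.mem_singleton, List.length_eq_zero_iff]
    exact ⟨fun h => ⟨h, by simp [h]⟩, fun h => h.1⟩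
  | succ i ih =>
    simp only [lists, Finset.mem_map, Finset.mem_product, Prod.exists, ih]
    constructor
    · rintro ⟨u, l', ⟨hu, hl, h⟩, rfl⟩
      exact ⟨congrArg (· + 1) hl, List.forall_mem_cons.mpr ⟨hu, h⟩⟩
    · rintro ⟨hl, h⟩
      cases l with
      | nil => simp at hl
      | cons u l =>
        simp only [List.mem_cons, forall_eq_or_imp] at h
        exact ⟨u, l, ⟨h.1, by simpa using hl, h.2⟩, rfl⟩

variable [DecidableEq V]

/-- The unnormalized probability that edges which choose an endpoint `u` with probability
proportional to `a u` plus the number of earlier choices of `u` make the choices recorded in the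
list, the most recent choice at the head. -/
def wt (a : V → ℝ) : List V → ℝ
  | [] => 1
  | u :: l => (a u + l.count u) * wt a l

lemma wt_congr {a b : V → ℝ} {l : List V} (h : ∀ u ∈ l, a u = b u) : wt a l = wt b l := by
  induction l with
  | nil => rfl
  | cons u l ih =>
    simp only [List.mem_cons, forall_eq_or_imp] at h
    rw [wt, wt, ih h.2, h.1]

/-- The weight depends on the multiset of choices only, because reinforcement is linear. -/
lemma wt_perm (a : V → ℝ) {l l' : List V} (h : l.Perm l') : wt a l = wt a l' := by
  induction h with
  | nil => rfl
  | cons u h ih => rw [wt, wt, ih, h.count_eq]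
  | swap u w l =>
    simp only [wt, List.count_cons, beq_iff_eq]
    by_cases huw : u = w
    · subst huw; ring
    · rw [if_neg huw, if_neg (Ne.symm huw)]; push_cast; ring
  | trans _ _ h1 h2 => rw [h1, h2]

lemma wt_append (a : V → ℝ) (l' l : List V) :
    wt a (l' ++ l) = wt (fun u => a u + l.count u) l' * wt a l := by
  induction l' with
  | nil => simp [wt]
  | cons u l' ih =>
    rw [List.cons_append, wt, wt, ih, List.count_append]
    push_cast; ring

lemma wt_nonneg {a : V → ℝ} {l : List V} (h : ∀ u ∈ l, 0 ≤ a u) : 0 ≤ wt a l := by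
  induction l with
  | nil => exact zero_le_one
  | cons u l ih =>
    simp only [List.mem_cons, forall_eq_or_imp] at h
    have := h.1
    exact mul_nonneg (by positivity) (ih h.2)

lemma wt_pos {a : V → ℝ} {l : List V} (h : ∀ u ∈ l, 0 < a u) : 0 < wt a l := by
  induction l with
  | nil => exact zero_lt_one
  | cons u l ih =>
    simp only [List.mem_cons, forall_eq_or_imp] at h
    have := h.1
    exact mul_pos (by positivity) (ih h.2)

/-- The product of the normalizing constants of `i` successive choices. -/
def pz (z : ℝ) (i : ℕ) : ℝ := ∏ j ∈ Finset.range i, (z + j)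

lemma pz_succ (z : ℝ) (i : ℕ) : pz z (i + 1) = pz z i * (z + i) := Finset.prod_range_succ _ _

lemma pz_pos {z : ℝ} (hz : 0 < z) (i : ℕ) : 0 < pz z i :=
  Finset.prod_pos fun j _ => by positivity

lemma sum_count_lists {S : Finset V} {i : ℕ} {l : List V} (hl : l ∈ lists S i) :
    ∑ u ∈ S, (l.count u : ℝ) = i := by
  obtain ⟨h1, h2⟩ := mem_lists.mp hl
  have h := Multiset.toFinset_sum_count_eq (l : Multiset V)
  have h3 : ∑ u ∈ S, l.count u = i := by
    simp_rw [← Multiset.coe_count]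
    rw [← h1, ← Multiset.coe_card, ← h]
    refine (Finset.sum_subset (f := fun u => Multiset.count u (l : Multiset V))
      (fun u hu => h2 u ?_) fun u _ hu => ?_).symm
    · rwa [Multiset.mem_toFinset] at hu
    · rw [Multiset.mem_toFinset] at hu
      exact Multiset.count_eq_zero.mpr hu
  exact_mod_cast h3

/-- The probability of the list `l` of `i` successive choices from `S`. -/
noncomputable def att (a : V → ℝ) (S : Finset V) (i : ℕ) (l : List V) : ℝ :=
  wt a l / pz (∑ u ∈ S, a u) i

lemma att_cons (a : V → ℝ) (S : Finset V) (i : ℕ) (u : V) (l : List V) :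
    att a S (i + 1) (u :: l) = att a S i l * ((a u + l.count u) / (∑ u ∈ S, a u + i)) := by
  rw [att, att, wt, pz_succ, div_mul_div_comm]
  ring

lemma att_nonneg {a : V → ℝ} {S : Finset V} (ha : ∀ u ∈ S, 0 ≤ a u) {i : ℕ} {l : List V}
    (hl : l ∈ lists S i) : 0 ≤ att a S i l :=
  div_nonneg (wt_nonneg fun u hu => ha u ((mem_lists.mp hl).2 u hu))
    (Finset.prod_nonneg fun _ _ => add_nonneg (Finset.sum_nonneg ha) (Nat.cast_nonneg _))

lemma sum_next {a : V → ℝ} {S : Finset V} (hZ : 0 < ∑ u ∈ S, a u) {i : ℕ} {l : List V}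
    (hl : l ∈ lists S i) : ∑ u ∈ S, (a u + l.count u) / (∑ u ∈ S, a u + i) = 1 := by
  rw [← Finset.sum_div, Finset.sum_add_distrib, sum_count_lists hl]
  exact div_self (by positivity)

lemma sum_att {a : V → ℝ} {S : Finset V} (hZ : 0 < ∑ u ∈ S, a u) (i : ℕ) :
    ∑ l ∈ lists S i, att a S i l = 1 := by
  induction i with
  | zero => simp [lists, att, wt, pz]
  | succ i ih =>
    rw [sum_lists_succ, ← ih]
    refine Finset.sum_congr rfl fun l hl => ?_
    simp_rw [att_cons]
    rw [← Finset.mul_sum, sum_next hZ hl, mul_one]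

/-- The expected value of the sum of `h` over the chosen vertices. The bound holds because each
single choice hits `u` with probability at most `(a u + i) / ∑ a`. -/
lemma sum_att_mul_sum_le {a h : V → ℝ} {S : Finset V} (ha : ∀ u ∈ S, 0 ≤ a u)
    (hZ : 0 < ∑ u ∈ S, a u) (hh : ∀ u ∈ S, 0 ≤ h u) (M : ℕ) {i : ℕ} (hi : i ≤ M) :
    ∑ l ∈ lists S i, att a S i l * (l.map h).sum
      ≤ i * ((∑ u ∈ S, (a u + M) * h u) / ∑ u ∈ S, a u) := by
  induction i with
  | zero => simp [lists]
  | succ i ih =>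
    set Z := ∑ u ∈ S, a u with hZdef
    set Q := (∑ u ∈ S, (a u + M) * h u) / Z with hQ
    have key : ∀ l ∈ lists S i,
        ∑ u ∈ S, att a S (i + 1) (u :: l) * ((u :: l).map h).sum
          ≤ att a S i l * Q + att a S i l * (l.map h).sum := by
      intro l hl
      have h1 : ∑ u ∈ S, att a S (i + 1) (u :: l) * ((u :: l).map h).sum
          = att a S i l * ∑ u ∈ S, (a u + l.count u) / (Z + i) * h u
            + att a S i l * (l.map h).sum * ∑ u ∈ S, (a u + l.count u) / (Z + i) := by
        rw [Finset.mul_sum, Finset.mul_sum, ← Finset.sum_add_distrib]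
        refine Finset.sum_congr rfl fun u _ => ?_
        rw [att_cons, List.map_cons, List.sum_cons]
        ring
      rw [h1, sum_next hZ hl, mul_one]
      gcongr
      · exact att_nonneg ha hl
      · rw [hQ, Finset.sum_div]
        refine Finset.sum_le_sum fun u hu => ?_
        have hc : (l.count u : ℝ) ≤ M := by
          have := l.count_le_length (a := u)
          rw [(mem_lists.mp hl).1] at this
          exact_mod_cast this.trans (by omega)
        have := ha u hu
        have := hh u hu
        rw [div_mul_eq_mul_div]
        gcongr
        simp
    rw [sum_lists_succ]
    refine (Finset.sum_le_sum key).trans ?_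
    rw [Finset.sum_add_distrib, ← Finset.sum_mul, sum_att hZ, one_mul]
    have := ih (by omega)
    push_cast
    linarith

end Lists

/-! ### One growth step -/

section Step

variable {V : Type*} [DecidableEq V]

/-- The graph `G` with a new vertex `v` joined by one edge to each entry of `l`. -/
def PAMultigraph.attach (G : PAMultigraph V) (v : V) (l : List V) : PAMultigraph V :=
  ⟨insert v G.verts, (l.map fun u => s(v, u) : List (Sym2 V)) + G.edges⟩

lemma deg_addEdge (G : PAMultigraph V) (v u w : V) :
    (G.addEdge v u).deg w = G.deg w + if w = v ∨ w = u then 1 else 0 := by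
  simp [PAMultigraph.deg, PAMultigraph.addEdge, Multiset.countP_cons]

lemma attach_cons (G : PAMultigraph V) (v u : V) (l : List V) :
    G.attach v (u :: l) = (G.attach v l).addEdge v u := by
  simp [PAMultigraph.attach, PAMultigraph.addEdge, ← Multiset.cons_coe]

lemma deg_attach_of_ne (G : PAMultigraph V) {v w : V} (hw : w ≠ v) (l : List V) :
    (G.attach v l).deg w = G.deg w + l.count w := by
  induction l with
  | nil => simp [PAMultigraph.attach, PAMultigraph.deg]
  | cons u l ih =>
    rw [attach_cons, deg_addEdge, ih, List.count_cons]
    simp only [hw, false_or, beq_iff_eq, eq_comm (a := u), add_assoc]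

lemma deg_attach_self (G : PAMultigraph V) (v : V) (l : List V) :
    (G.attach v l).deg v = G.deg v + l.length := by
  induction l with
  | nil => simp [PAMultigraph.attach, PAMultigraph.deg]
  | cons u l ih =>
    rw [attach_cons, deg_addEdge, ih]
    simp [add_assoc]

lemma attach_comm (G : PAMultigraph V) (v v' : V) (l l' : List V) :
    (G.attach v l).attach v' l' = (G.attach v' l').attach v l := by
  simp only [PAMultigraph.attach]
  rw [Finset.insert_comm, add_left_comm]

/-- The properties of the graphs that occur in the model which the argument uses: every vertex has
degree at least `m`, and `m (|G| - 1)` edges have been added. -/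
structure Good (m : ℕ) (G : PAMultigraph V) : Prop where
  two_le : 2 ≤ G.verts.card
  deg_off : ∀ u ∉ G.verts, G.deg u = 0
  le_deg : ∀ u ∈ G.verts, m ≤ G.deg u
  sum_deg : ∑ u ∈ G.verts, G.deg u + 2 * m = 2 * m * G.verts.card

lemma ne_of_mem_lists {V : Type*} {S : Finset V} {i : ℕ} {l : List V} {v : V} (hv : v ∉ S)
    (hl : l ∈ lists S i) : ∀ u ∈ l, u ≠ v := fun u hu h => hv (h ▸ (mem_lists.mp hl).2 u hu)

lemma sum_count_lists_nat {S : Finset V} {i : ℕ} {l : List V} (hl : l ∈ lists S i) :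
    ∑ u ∈ S, l.count u = i := by
  exact_mod_cast sum_count_lists hl

lemma Good.attach {m : ℕ} {G : PAMultigraph V} (hG : Good m G) {v : V} {l : List V}
    (hv : v ∉ G.verts) (hl : l ∈ lists G.verts m) : Good m (G.attach v l) := by
  have hne : ∀ u ∈ G.verts, u ≠ v := fun u hu h => hv (h ▸ hu)
  refine ⟨?_, fun u hu => ?_, fun u hu => ?_, ?_⟩
  · simp only [PAMultigraph.attach, Finset.card_insert_of_notMem hv]
    have := hG.two_le
    omega
  · simp only [PAMultigraph.attach, Finset.mem_insert, not_or] at hu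
    rw [deg_attach_of_ne _ hu.1, hG.deg_off u hu.2, List.count_eq_zero.mpr]
    exact fun h => hu.2 ((mem_lists.mp hl).2 u h)
  · simp only [PAMultigraph.attach, Finset.mem_insert] at hu
    rcases hu with rfl | hu
    · rw [deg_attach_self, (mem_lists.mp hl).1]
      omega
    · rw [deg_attach_of_ne _ (hne u hu)]
      have := hG.le_deg u hu
      omega
  · have h1 : (G.attach v l).verts = insert v G.verts := rfl
    rw [h1, Finset.sum_insert hv, Finset.card_insert_of_notMem hv, deg_attach_self,
      (mem_lists.mp hl).1, hG.deg_off v hv,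
      Finset.sum_congr rfl fun u hu => deg_attach_of_ne G (hne u hu) l,
      Finset.sum_add_distrib, sum_count_lists_nat hl]
    have := hG.sum_deg
    linarith

/-- The weights that govern the choice of the targets. -/
def PAMultigraph.shift (G : PAMultigraph V) (δ : ℝ) (u : V) : ℝ := G.deg u + δ

lemma Good.sum_shift {m : ℕ} {G : PAMultigraph V} (hG : Good m G) (δ : ℝ) :
    ∑ u ∈ G.verts, G.shift δ u = 2 * m * (G.verts.card - 1) + G.verts.card * δ := by
  have h : ((∑ u ∈ G.verts, G.deg u + 2 * m : ℕ) : ℝ) = (2 * m * G.verts.card : ℕ) := by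
    rw [hG.sum_deg]
  push_cast at h
  simp only [PAMultigraph.shift, Finset.sum_add_distrib, Finset.sum_const, nsmul_eq_mul]
  linarith

lemma Good.le_sum_shift {m : ℕ} {G : PAMultigraph V} (hG : Good m G) (δ : ℝ) :
    G.verts.card * (m + δ) ≤ ∑ u ∈ G.verts, G.shift δ u := by
  rw [hG.sum_shift]
  have h2 : (2 : ℝ) ≤ G.verts.card := by exact_mod_cast hG.two_le
  have hm : (0 : ℝ) ≤ m := Nat.cast_nonneg _
  nlinarith

lemma Good.sum_shift_pos {m : ℕ} {G : PAMultigraph V} (hG : Good m G) {δ : ℝ}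
    (hδ : -(m : ℝ) < δ) : 0 < ∑ u ∈ G.verts, G.shift δ u := by
  refine lt_of_lt_of_le ?_ (hG.le_sum_shift δ)
  have h2 : (2 : ℝ) ≤ G.verts.card := by exact_mod_cast hG.two_le
  have : 0 < m + δ := by linarith
  positivity

lemma Good.shift_nonneg {m : ℕ} {G : PAMultigraph V} (hG : Good m G) {δ : ℝ}
    (hδ : -(m : ℝ) < δ) : ∀ u ∈ G.verts, 0 ≤ G.shift δ u := fun u hu => by
  have : (m : ℝ) ≤ G.deg u := by exact_mod_cast hG.le_deg u hu
  simp only [PAMultigraph.shift]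
  linarith

variable [Fintype V]

/-- The vertices not yet present. -/
abbrev PAMultigraph.free (G : PAMultigraph V) : Finset V := Finset.univ \ G.verts

/-- The mean of `F v l` for the random new vertex `v` and its random list `l` of `m` targets in one
growth step from `G`. -/
noncomputable def stepMean (m : ℕ) (δ : ℝ) (G : PAMultigraph V) :
    (V → List V → ℝ) →ₗ[ℝ] ℝ where
  toFun F := ∑ v ∈ G.free, (G.free.card : ℝ)⁻¹ *
    ∑ l ∈ lists G.verts m, att (G.shift δ) G.verts m l * F v l
  map_add' F F' := by simp only [Pi.add_apply, mul_add, Finset.sum_add_distrib]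
  map_smul' c F := by
    simp only [Pi.smul_apply, smul_eq_mul, RingHom.id_apply, Finset.mul_sum]
    refine Finset.sum_congr rfl fun v _ => Finset.sum_congr rfl fun l _ => by ring

lemma stepMean_apply (m : ℕ) (δ : ℝ) (G : PAMultigraph V) (F : V → List V → ℝ) :
    stepMean m δ G F = ∑ v ∈ G.free, (G.free.card : ℝ)⁻¹ *
      ∑ l ∈ lists G.verts m, att (G.shift δ) G.verts m l * F v l := rfl

lemma mem_free {G : PAMultigraph V} {v : V} : v ∈ G.free ↔ v ∉ G.verts := by simp

lemma stepMean_mono {m : ℕ} {δ : ℝ} (hδ : -(m : ℝ) < δ) {G : PAMultigraph V} (hG : Good m G)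
    {F F' : V → List V → ℝ} (h : ∀ v ∉ G.verts, ∀ l ∈ lists G.verts m, F v l ≤ F' v l) :
    stepMean m δ G F ≤ stepMean m δ G F' := by
  rw [stepMean_apply, stepMean_apply]
  refine Finset.sum_le_sum fun v hv => mul_le_mul_of_nonneg_left
    (Finset.sum_le_sum fun l hl => ?_) (by positivity)
  exact mul_le_mul_of_nonneg_left (h v (mem_free.mp hv) l hl) (att_nonneg (hG.shift_nonneg hδ) hl)

lemma stepMean_congr {m : ℕ} {δ : ℝ} {G : PAMultigraph V}
    {F F' : V → List V → ℝ} (h : ∀ v ∉ G.verts, ∀ l ∈ lists G.verts m, F v l = F' v l) :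
    stepMean m δ G F = stepMean m δ G F' := by
  rw [stepMean_apply, stepMean_apply]
  refine Finset.sum_congr rfl fun v hv => ?_
  rw [Finset.sum_congr rfl fun l hl => by rw [h v (mem_free.mp hv) l hl]]

lemma card_free (G : PAMultigraph V) : G.free.card = Fintype.card V - G.verts.card := by
  rw [Finset.card_sdiff_of_subset (Finset.subset_univ _), Finset.card_univ]

lemma sum_free_inv {G : PAMultigraph V} (hc : G.verts.card < Fintype.card V) (x : ℝ) :
    ∑ _v ∈ G.free, (G.free.card : ℝ)⁻¹ * x = x := by
  have : 0 < G.free.card := by rw [card_free]; omega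
  rw [Finset.sum_const, nsmul_eq_mul]
  field_simp

lemma stepMean_const {m : ℕ} {δ : ℝ} (hδ : -(m : ℝ) < δ) {G : PAMultigraph V} (hG : Good m G)
    (hc : G.verts.card < Fintype.card V) (c : ℝ) : stepMean m δ G (fun _ _ => c) = c := by
  simp_rw [stepMean_apply, ← Finset.sum_mul _ _ c, sum_att (hG.sum_shift_pos hδ), one_mul,
    sum_free_inv hc]

lemma stepMean_map_sum_le {m : ℕ} {δ : ℝ} (hδ : -(m : ℝ) < δ) {G : PAMultigraph V}
    (hG : Good m G) (hc : G.verts.card < Fintype.card V) {h : V → ℝ}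
    (hh : ∀ u ∈ G.verts, 0 ≤ h u) :
    stepMean m δ G (fun _ l => (l.map h).sum)
      ≤ m * ((∑ u ∈ G.verts, (G.shift δ u + m) * h u) / ∑ u ∈ G.verts, G.shift δ u) := by
  rw [stepMean_apply]
  refine (Finset.sum_le_sum fun v _ => mul_le_mul_of_nonneg_left
    (sum_att_mul_sum_le (hG.shift_nonneg hδ) (hG.sum_shift_pos hδ) hh m le_rfl)
    (by positivity)).trans_eq ?_
  rw [sum_free_inv hc]

/-- Two growth steps as a sum over pairs of new vertices and pairs of target lists, for a function
that vanishes if the second vertex is attached to the first. -/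
lemma stepMean_stepMean {m : ℕ} {δ : ℝ} {G : PAMultigraph V} (hG : Good m G)
    {H : V → List V → V → List V → ℝ} (hH : ∀ v l v' l', v ∈ l' → H v l v' l' = 0) :
    stepMean m δ G (fun v l => stepMean m δ (G.attach v l) (fun v' l' => H v l v' l'))
      = ((G.free.card : ℝ)⁻¹ * ((G.free.card - 1 : ℕ) : ℝ)⁻¹
          * (pz (∑ u ∈ G.verts, G.shift δ u) m)⁻¹
          * (pz (∑ u ∈ G.verts, G.shift δ u + (2 * m + δ)) m)⁻¹)
        * ∑ v ∈ G.free, ∑ v' ∈ G.free, ∑ l ∈ lists G.verts m, ∑ l' ∈ lists G.verts m,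
          if v = v' then 0 else wt (G.shift δ) (l' ++ l) * H v l v' l' := by
  rw [stepMean_apply]
  simp only [Finset.mul_sum]
  refine Finset.sum_congr rfl fun v hv => ?_
  rw [Finset.sum_comm]
  refine Finset.sum_congr rfl fun l hl => ?_
  rw [mem_free] at hv
  have hne : ∀ u ∈ G.verts, u ≠ v := fun u hu h => hv (h ▸ hu)
  have hverts : (G.attach v l).verts = insert v G.verts := rfl
  have hfree : (G.attach v l).free = G.free.erase v := by
    ext w
    simp [hverts]
  have hcard : (G.attach v l).free.card = G.free.card - 1 := by
    rw [hfree, Finset.card_erase_of_mem (mem_free.mpr hv)]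
  have hZ : ∑ u ∈ (G.attach v l).verts, (G.attach v l).shift δ u
      = ∑ u ∈ G.verts, G.shift δ u + (2 * m + δ) := by
    rw [(hG.attach hv hl).sum_shift, hG.sum_shift, hverts, Finset.card_insert_of_notMem hv]
    push_cast
    ring
  rw [stepMean_apply, hcard, hfree, Finset.mul_sum, Finset.mul_sum,
    ← Finset.sum_erase_add _ _ (mem_free.mpr hv)]
  have hzero : ∑ i ∈ lists G.verts m, (G.free.card : ℝ)⁻¹ * ((G.free.card - 1 : ℕ) : ℝ)⁻¹
          * (pz (∑ u ∈ G.verts, G.shift δ u) m)⁻¹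
          * (pz (∑ u ∈ G.verts, G.shift δ u + (2 * m + δ)) m)⁻¹ *
          (if v = v then 0 else wt (G.shift δ) (i ++ l) * H v l v i) = 0 := by simp
  rw [hzero, add_zero]
  refine Finset.sum_congr rfl fun v' hv' => ?_
  have hvv' : v ≠ v' := fun h => by simp [h] at hv'
  have hsub : lists G.verts m ⊆ lists (G.attach v l).verts m := fun l' hl' => by
    rw [mem_lists] at hl' ⊢
    exact ⟨hl'.1, fun u hu => Finset.mem_insert_of_mem (hl'.2 u hu)⟩
  rw [← Finset.sum_subset hsub fun l' hl' hl'' => ?_, Finset.mul_sum, Finset.mul_sum,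
    Finset.mul_sum]
  · refine Finset.sum_congr rfl fun l' hl' => ?_
    rw [if_neg hvv', wt_append, att, att, hZ, wt_congr (a := (G.attach v l).shift δ)
      (b := fun u => G.shift δ u + l.count u) (l := l') fun u hu => ?_]
    · ring
    · simp only [PAMultigraph.shift]
      rw [deg_attach_of_ne G (ne_of_mem_lists hv hl' u hu) l]
      push_cast
      ring
  · rw [hH, mul_zero]
    by_contra hvl'
    refine hl'' (mem_lists.mpr ⟨(mem_lists.mp hl').1, fun u hu => ?_⟩)
    rcases Finset.mem_insert.mp ((mem_lists.mp hl').2 u hu) with rfl | h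
    · exact absurd hu hvl'
    · exact h

/-- The last two vertices can be exchanged unless one is attached to the other. -/
lemma stepMean_swap {m : ℕ} {δ : ℝ} {G : PAMultigraph V} (hG : Good m G)
    {H : V → List V → V → List V → ℝ} (hH : ∀ v l v' l', v ∈ l' → H v l v' l' = 0)
    (hH' : ∀ v l v' l', v' ∈ l → H v l v' l' = 0) :
    stepMean m δ G (fun v l => stepMean m δ (G.attach v l) (fun v' l' => H v l v' l'))
      = stepMean m δ G (fun v l => stepMean m δ (G.attach v l) (fun v' l' => H v' l' v l)) := by
  rw [stepMean_stepMean hG hH,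
    stepMean_stepMean hG (H := fun v l v' l' => H v' l' v l) fun v l v' l' h => hH' _ _ _ _ h,
    Finset.sum_comm]
  congr 1
  refine Finset.sum_congr rfl fun v _ => Finset.sum_congr rfl fun v' _ => ?_
  rw [Finset.sum_comm]
  refine Finset.sum_congr rfl fun l _ => Finset.sum_congr rfl fun l' _ => ?_
  rw [wt_perm _ (List.perm_append_comm (l₁ := l) (l₂ := l'))]
  simp only [eq_comm (a := v)]

end Step

/-! ### Histories and the exchange identity -/

section History

/-- A connected component of the graph spanned by the vertices that arrived after a reference time.
The number of its vertices is kept separately as `size`, and `targets` is the list of targets of its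
most recent vertex. -/
@[ext]
structure Block (V : Type*) where
  verts : Finset V
  size : ℕ
  targets : List V

/-- A graph with the components of its recent vertices. -/
@[ext]
structure History (V : Type*) where
  graph : PAMultigraph V
  blocks : Multiset (Block V)

variable {V : Type*} [DecidableEq V]

/-- A list of targets hits a block if it contains a vertex of the block. -/
abbrev Block.Hit (B : Block V) (l : List V) : Prop := ∃ u ∈ l, u ∈ B.verts

/-- The component of a new vertex `v` with targets `l`: all blocks hit by `l` are merged. -/
def History.newBlock (X : History V) (v : V) (l : List V) : Block V where
  verts := insert v ((X.blocks.filter (·.Hit l)).map Block.verts).sup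
  size := 1 + ((X.blocks.filter (·.Hit l)).map Block.size).sum
  targets := l

/-- The history after the arrival of `v` with targets `l`. -/
def History.step (X : History V) (v : V) (l : List V) : History V where
  graph := X.graph.attach v l
  blocks := X.newBlock v l ::ₘ X.blocks.filter (¬ ·.Hit l)

lemma blocks_step (X : History V) (v : V) (l : List V) :
    (X.step v l).blocks = X.newBlock v l ::ₘ X.blocks.filter (¬ ·.Hit l) := rfl

/-- The vertices `v`, `v'` with targets `l`, `l'`, added to `X`, end up in different blocks. -/
def History.Apart (X : History V) (v : V) (l : List V) (v' : V) (l' : List V) : Prop :=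
  v ∉ l' ∧ v' ∉ l ∧ ∀ B ∈ X.blocks, ¬ (B.Hit l ∧ B.Hit l')

lemma History.Apart.symm {V : Type*} {X : History V} {v v' : V} {l l' : List V}
    (h : X.Apart v l v' l') : X.Apart v' l' v l :=
  ⟨h.2.1, h.1, fun B hB hh => h.2.2 B hB hh.symm⟩

lemma mem_multiset_sup {s : Multiset (Finset V)} {u : V} : u ∈ s.sup ↔ ∃ t ∈ s, u ∈ t := by
  induction s using Multiset.induction with
  | empty => simp
  | cons t s ih => simp [ih]

lemma newBlock_hit_iff {X : History V} {v : V} {l l' : List V} :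
    (X.newBlock v l).Hit l' ↔ v ∈ l' ∨ ∃ B ∈ X.blocks, B.Hit l ∧ B.Hit l' := by
  simp only [Block.Hit, History.newBlock, Finset.mem_insert, mem_multiset_sup, Multiset.mem_map,
    Multiset.mem_filter]
  constructor
  · rintro ⟨u, hu, rfl | ⟨_, ⟨B, ⟨hB, hl⟩, rfl⟩, huB⟩⟩
    · exact Or.inl hu
    · exact Or.inr ⟨B, hB, hl, u, hu, huB⟩
  · rintro (h | ⟨B, hB, hl, u, hu, huB⟩)
    · exact ⟨v, h, Or.inl rfl⟩
    · exact ⟨u, hu, Or.inr ⟨_, ⟨B, ⟨hB, hl⟩, rfl⟩, huB⟩⟩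

lemma apart_iff {X : History V} {v v' : V} {l l' : List V} (h : v' ∉ l) :
    X.Apart v l v' l' ↔ ¬ (X.newBlock v l).Hit l' := by
  rw [newBlock_hit_iff, History.Apart]
  push Not
  simp only [h, not_false_eq_true, true_and]

lemma History.Apart.newBlock_step {X : History V} {v v' : V} {l l' : List V}
    (h : X.Apart v l v' l') : (X.step v l).newBlock v' l' = X.newBlock v' l' := by
  have h1 : (X.step v l).blocks.filter (·.Hit l') = X.blocks.filter (·.Hit l') := by
    rw [blocks_step, Multiset.filter_cons_of_neg (p := fun B : Block V => B.Hit l') _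
      ((apart_iff h.2.1).mp h), Multiset.filter_filter]
    refine Multiset.filter_congr fun B hB => ?_
    have := h.2.2 B hB
    exact ⟨fun h => h.1, fun h' => ⟨h', fun h'' => this ⟨h'', h'⟩⟩⟩
  rw [History.newBlock, h1, History.newBlock]

lemma History.Apart.step_comm {X : History V} {v v' : V} {l l' : List V}
    (h : X.Apart v l v' l') : (X.step v l).step v' l' = (X.step v' l').step v l := by
  have h1 : ∀ {v v' : V} {l l' : List V}, X.Apart v l v' l' →
      (X.step v l).blocks.filter (¬ ·.Hit l')
        = X.newBlock v l ::ₘ X.blocks.filter (fun B => ¬ B.Hit l ∧ ¬ B.Hit l') := by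
    intro v v' l l' h
    rw [blocks_step, Multiset.filter_cons_of_pos (p := fun B : Block V => ¬ B.Hit l') _
      ((apart_iff h.2.1).mp h), Multiset.filter_filter]
    congr 1
    exact Multiset.filter_congr fun B _ => and_comm
  have h2 : ∀ {v v' : V} {l l' : List V}, (X.step v l).step v' l'
      = ⟨(X.graph.attach v l).attach v' l',
        (X.step v l).newBlock v' l' ::ₘ (X.step v l).blocks.filter (¬ ·.Hit l')⟩ := rfl
  rw [h2, h2, h1 h, h1 h.symm, h.newBlock_step, h.symm.newBlock_step, attach_comm,
    Multiset.cons_swap]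
  congr 3
  exact Multiset.filter_congr fun B _ => and_comm

/-- The number of recent vertices. -/
def History.total (X : History V) : ℕ := (X.blocks.map Block.size).sum

lemma sum_map_filter {α M : Type*} [AddCommMonoid M] (s : Multiset α) (p : α → Prop)
    [DecidablePred p] (f : α → M) :
    ((s.filter p).map f).sum = (s.map fun a => if p a then f a else 0).sum := by
  induction s using Multiset.induction with
  | empty => simp
  | cons a s ih => by_cases h : p a <;> simp [h, ih]

lemma newBlock_size_add (X : History V) (v : V) (l : List V) :
    (X.newBlock v l).size + ((X.blocks.filter (¬ ·.Hit l)).map Block.size).sum = X.total + 1 := by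
  rw [History.newBlock, History.total]
  conv_rhs => rw [← Multiset.filter_add_not (·.Hit l) X.blocks, Multiset.map_add, Multiset.sum_add]
  ring

lemma total_step (X : History V) (v : V) (l : List V) : (X.step v l).total = X.total + 1 := by
  rw [← newBlock_size_add X v l, History.total, History.step, Multiset.map_cons, Multiset.sum_cons]

/-- The properties of the histories that are reached in `j` steps from a graph with `s` vertices. -/
structure Valid (m s j : ℕ) (X : History V) : Prop where
  good : Good m X.graph
  total_eq : X.total = j
  card_eq : X.graph.verts.card = s + j
  subset : ∀ B ∈ X.blocks, B.verts ⊆ X.graph.verts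
  card_le : ∀ B ∈ X.blocks, B.verts.card ≤ B.size
  sum_deg_le : ∀ B ∈ X.blocks, ∑ u ∈ B.verts, X.graph.deg u ≤ 2 * m * B.size
  length_eq : ∀ B ∈ X.blocks, B.targets.length = m
  count_le : ∀ B ∈ X.blocks, ∀ u ∈ B.targets, m + B.targets.count u ≤ X.graph.deg u
  target_mem : ∀ B ∈ X.blocks, ∀ u ∈ B.targets, u ∈ X.graph.verts

lemma Good.valid {G : PAMultigraph V} (hG : Good m G) :
    Valid m G.verts.card 0 (⟨G, 0⟩ : History V) where
  good := hG
  total_eq := by simp [History.total]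
  card_eq := by simp
  subset := by simp
  card_le := by simp
  sum_deg_le := by simp
  length_eq := by simp
  count_le := by simp
  target_mem := by simp

lemma sum_multiset_sup_le (h : V → ℕ) (s : Multiset (Finset V)) :
    ∑ u ∈ s.sup, h u ≤ (s.map fun t => ∑ u ∈ t, h u).sum := by
  induction s using Multiset.induction with
  | empty => simp
  | cons t s ih =>
    rw [Multiset.sup_cons, Multiset.map_cons, Multiset.sum_cons, Finset.sup_eq_union]
    have := Finset.sum_union_inter (s₁ := t) (s₂ := s.sup) (f := h)
    omega

lemma Valid.step {m s j : ℕ} {X : History V} (hX : Valid m s j X) {v : V} {l : List V}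
    (hv : v ∉ X.graph.verts) (hl : l ∈ lists X.graph.verts m) :
    Valid m s (j + 1) (X.step v l) := by
  have hne : ∀ u ∈ X.graph.verts, u ≠ v := fun u hu h => hv (h ▸ hu)
  have hverts : (X.step v l).graph.verts = insert v X.graph.verts := rfl
  have hdeg : ∀ u ∈ X.graph.verts, (X.step v l).graph.deg u = X.graph.deg u + l.count u :=
    fun u hu => deg_attach_of_ne _ (hne u hu) l
  have hdegv : (X.step v l).graph.deg v = m := by
    rw [History.step, deg_attach_self, hX.good.deg_off v hv, (mem_lists.mp hl).1, zero_add]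
  set M := X.blocks.filter (·.Hit l) with hM
  have hMX : ∀ B ∈ M, B ∈ X.blocks := fun B hB => (Multiset.mem_filter.mp hB).1
  have hsup : (M.map Block.verts).sup ⊆ X.graph.verts := by
    intro u hu
    obtain ⟨_, ht, hut⟩ := mem_multiset_sup.mp hu
    obtain ⟨B, hB, rfl⟩ := Multiset.mem_map.mp ht
    exact hX.subset B (hMX B hB) hut
  have hvsup : v ∉ (M.map Block.verts).sup := fun h => hv (hsup h)
  have hbound : ∀ (f : V → ℕ) (c : ℕ), (∀ B ∈ X.blocks, ∑ u ∈ B.verts, f u ≤ c * B.size) →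
      ∑ u ∈ (M.map Block.verts).sup, f u ≤ c * (M.map Block.size).sum := by
    intro f c h
    refine (sum_multiset_sup_le f _).trans ?_
    rw [Multiset.map_map, ← Multiset.sum_map_mul_left]
    exact Multiset.sum_map_le_sum_map _ _ fun B hB => h B (hMX B hB)
  have hmem : ∀ B ∈ (X.step v l).blocks,
      B = X.newBlock v l ∨ (B ∈ X.blocks ∧ ¬ B.Hit l) := fun B hB => by
    rw [History.step, Multiset.mem_cons, Multiset.mem_filter] at hB
    exact hB
  refine ⟨hX.good.attach hv hl, ?_, ?_, ?_, ?_, ?_, ?_, ?_, ?_⟩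
  · rw [total_step, hX.total_eq]
  · rw [hverts, Finset.card_insert_of_notMem hv, hX.card_eq, add_assoc]
  · intro B hB
    rw [hverts]
    rcases hmem B hB with rfl | ⟨hB, -⟩
    · exact Finset.insert_subset_insert _ hsup
    · exact (hX.subset B hB).trans (Finset.subset_insert _ _)
  · intro B hB
    rcases hmem B hB with rfl | ⟨hB, -⟩
    · have := hbound (fun _ => 1) 1 fun B hB => by simpa using hX.card_le B hB
      simp only [Finset.sum_const, smul_eq_mul, mul_one, one_mul] at this
      rw [History.newBlock, Finset.card_insert_of_notMem hvsup]
      exact (Nat.add_comm _ _).trans_le (Nat.add_le_add_left this 1)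
    · exact hX.card_le B hB
  · intro B hB
    rcases hmem B hB with rfl | ⟨hB, hhit⟩
    · have h1 : (X.newBlock v l).verts = insert v (M.map Block.verts).sup := rfl
      have h2 : (X.newBlock v l).size = 1 + (M.map Block.size).sum := rfl
      rw [h1, h2, Finset.sum_insert hvsup, hdegv,
        Finset.sum_congr rfl fun u hu => hdeg u (hsup hu), Finset.sum_add_distrib]
      have h3 := hbound X.graph.deg (2 * m) hX.sum_deg_le
      have h4 : ∑ u ∈ (M.map Block.verts).sup, l.count u ≤ m := by
        rw [← sum_count_lists_nat hl]
        exact Finset.sum_le_sum_of_subset hsup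
      rw [mul_add]
      omega
    · refine le_trans (Finset.sum_le_sum fun u hu => ?_) (hX.sum_deg_le B hB)
      rw [hdeg u (hX.subset B hB hu), List.count_eq_zero.mpr fun h => hhit ⟨u, h, hu⟩, add_zero]
  · intro B hB
    rcases hmem B hB with rfl | ⟨hB, -⟩
    · exact (mem_lists.mp hl).1
    · exact hX.length_eq B hB
  · intro B hB u hu
    rcases hmem B hB with rfl | ⟨hB, -⟩
    · have huX : u ∈ X.graph.verts := (mem_lists.mp hl).2 u hu
      rw [hdeg u huX]
      exact Nat.add_le_add_right (hX.good.le_deg u huX) _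
    · rw [hdeg u (hX.target_mem B hB u hu)]
      exact (hX.count_le B hB u hu).trans (Nat.le_add_right _ _)
  · intro B hB u hu
    rw [hverts]
    refine Finset.mem_insert_of_mem ?_
    rcases hmem B hB with rfl | ⟨hB, -⟩
    · exact (mem_lists.mp hl).2 u hu
    · exact hX.target_mem B hB u hu

variable [Fintype V]

/-- The transition operator of the history. -/
noncomputable def stepOp (m : ℕ) (δ : ℝ) : Module.End ℝ (History V → ℝ) where
  toFun F X := stepMean m δ X.graph fun v l => F (X.step v l)
  map_add' F F' := by ext X; exact map_add (stepMean m δ X.graph) _ _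
  map_smul' c F := by ext X; exact map_smul (stepMean m δ X.graph) c _

/-- The mean after one step of a function of the history and of the block of the new vertex. -/
noncomputable def newMean (m : ℕ) (δ : ℝ) :
    (History V → Block V → ℝ) →ₗ[ℝ] (History V → ℝ) where
  toFun F X := stepMean m δ X.graph fun v l => F (X.step v l) (X.newBlock v l)
  map_add' F F' := by ext X; exact map_add (stepMean m δ X.graph) _ _
  map_smul' c F := by ext X; exact map_smul (stepMean m δ X.graph) c _

/-- The sum of a function over the blocks, each weighted by its size. -/
def blockSum (F : History V → Block V → ℝ) (X : History V) : ℝ :=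
  (X.blocks.map fun B => B.size * F X B).sum

lemma pow_stepOp_mono {m s : ℕ} {δ : ℝ} (hδ : -(m : ℝ) < δ) {F F' : History V → ℝ} (j : ℕ) :
    ∀ {i : ℕ} {X : History V}, Valid m s i X → (∀ Y, Valid m s (i + j) Y → F Y ≤ F' Y) →
      (stepOp m δ ^ j) F X ≤ (stepOp m δ ^ j) F' X := by
  induction j with
  | zero => intro i X hX h; exact h X hX
  | succ j ih =>
    intro i X hX h
    rw [pow_succ', Module.End.mul_apply, Module.End.mul_apply]
    refine stepMean_mono hδ hX.good fun v hv l hl => ih (hX.step hv hl) fun Y hY => h Y ?_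
    rwa [add_assoc, add_comm 1 j] at hY

lemma pow_stepOp_congr {m s : ℕ} {δ : ℝ} (hδ : -(m : ℝ) < δ) {F F' : History V → ℝ} {j : ℕ}
    {X : History V} (hX : Valid m s 0 X) (h : ∀ Y, Valid m s j Y → F Y = F' Y) :
    (stepOp m δ ^ j) F X = (stepOp m δ ^ j) F' X :=
  le_antisymm
    (pow_stepOp_mono hδ j hX fun Y hY => (h Y (by rwa [zero_add] at hY)).le)
    (pow_stepOp_mono hδ j hX fun Y hY => (h Y (by rwa [zero_add] at hY)).ge)

lemma stepMean_multiset_sum {α : Type*} (m : ℕ) (δ : ℝ) (G : PAMultigraph V) (s : Multiset α)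
    (f : α → V → List V → ℝ) :
    stepMean m δ G (fun v l => (s.map fun a => f a v l).sum)
      = (s.map fun a => stepMean m δ G (f a)).sum := by
  induction s using Multiset.induction with
  | empty => exact map_zero (stepMean m δ G)
  | cons a s ih =>
    simp only [Multiset.map_cons, Multiset.sum_cons, ← ih]
    exact map_add (stepMean m δ G) _ _

/-- The weighted sum of `F` over the blocks that are not merged in the next step, as a weighted sum
over the present blocks. -/
lemma stepMean_blockSum (m : ℕ) (δ : ℝ) (X : History V) (F : Block V → V → List V → ℝ) :
    stepMean m δ X.graph
        (fun v l => ((X.blocks.filter (¬ ·.Hit l)).map fun B => B.size * F B v l).sum)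
      = (X.blocks.map fun B => B.size *
          stepMean m δ X.graph fun v l => if B.Hit l then 0 else F B v l).sum := by
  simp only [sum_map_filter]
  rw [stepMean_multiset_sum]
  congr 1
  refine Multiset.map_congr rfl fun B _ => ?_
  rw [← smul_eq_mul, ← map_smul]
  refine stepMean_congr fun v _ l _ => ?_
  by_cases h : B.Hit l <;> simp [h]

/-- The exchange identity: given the graph and its blocks, the newest vertex is the last vertex of
a block that is chosen with probability proportional to its size. -/
theorem pow_stepOp_blockSum {m s : ℕ} {δ : ℝ} (hδ : -(m : ℝ) < δ) {X : History V}
    (hX : Valid m s 0 X) (hX0 : X.blocks = 0) (j : ℕ) (F : History V → Block V → ℝ) :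
    (stepOp m δ ^ (j + 1)) (blockSum F) X
      = (j + 1) * (stepOp m δ ^ j) (newMean m δ F) X := by
  induction j generalizing F with
  | zero =>
    rw [zero_add, pow_one, pow_zero, Module.End.one_apply, Nat.cast_zero, zero_add, one_mul]
    refine stepMean_congr fun v _ l _ => ?_
    simp [blockSum, History.step, History.newBlock, hX0]
  | succ j ih =>
    set F₁ : History V → Block V → ℝ := fun Y B => B.size * F Y B with hF₁
    set F₂ : History V → Block V → ℝ := fun Y B =>
      stepMean m δ Y.graph fun v l => if B.Hit l then 0 else F (Y.step v l) B with hF₂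
    set F₃ : History V → Block V → ℝ := fun Y B =>
      stepMean m δ Y.graph fun v l => if B.Hit l then 0 else F (Y.step v l) (Y.newBlock v l)
      with hF₃
    have h1 : stepOp m δ (blockSum F) = newMean m δ F₁ + blockSum F₂ := by
      ext Y
      have e : blockSum F₂ Y = _ :=
        (stepMean_blockSum m δ Y fun B v l => F (Y.step v l) B).symm
      rw [Pi.add_apply, e]
      refine Eq.trans ?_ (map_add (stepMean m δ Y.graph) _ _)
      refine stepMean_congr fun v _ l _ => ?_
      rw [blockSum, History.step, Multiset.map_cons, Multiset.sum_cons]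
      rfl
    -- The block of the last but one vertex is exchanged with the block of the last one.
    have h2 : ∀ Y, Valid m s j Y → newMean m δ F₂ Y = newMean m δ F₃ Y := by
      classical
      intro Y hY
      set H : V → List V → V → List V → ℝ := fun v l v' l' =>
        if Y.Apart v l v' l' then F ((Y.step v l).step v' l') (Y.newBlock v l) else 0 with hH
      refine Eq.trans ?_ ((stepMean_swap (δ := δ) (H := H) hY.good ?_ ?_).trans ?_)
      · refine stepMean_congr fun v hv l hl => stepMean_congr fun v' hv' l' hl' => ?_
        have hv'l : v' ∉ l := fun h => hv' (Finset.mem_insert_of_mem ((mem_lists.mp hl).2 v' h))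
        simp only [hH, apart_iff hv'l, ite_not]
      · intro v l v' l' h
        rw [hH]
        exact if_neg fun h' => h'.1 h
      · intro v l v' l' h
        rw [hH]
        exact if_neg fun h' => h'.2.1 h
      · refine stepMean_congr fun v hv l hl => stepMean_congr fun v' hv' l' hl' => ?_
        have hv'l : v' ∉ l := fun h => hv' (Finset.mem_insert_of_mem ((mem_lists.mp hl).2 v' h))
        by_cases h : Y.Apart v l v' l'
        · simp only [hH]
          rw [if_pos h.symm, if_neg ((apart_iff hv'l).mp h), h.newBlock_step, h.step_comm]
        · simp only [hH]
          rw [if_neg fun h' => h h'.symm, if_pos (by_contra fun h' => h ((apart_iff hv'l).mpr h'))]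
    have h3 : ∀ Y, Valid m s (j + 1) Y →
        (newMean m δ F₁ + blockSum F₃) Y = (((j : ℝ) + 1 + 1) • newMean m δ F) Y := by
      intro Y hY
      have e : blockSum F₃ Y = _ :=
        (stepMean_blockSum m δ Y fun _ v l => F (Y.step v l) (Y.newBlock v l)).symm
      rw [Pi.add_apply, e, Pi.smul_apply]
      refine Eq.trans (map_add (stepMean m δ Y.graph) _ _).symm
        (Eq.trans ?_ (map_smul (stepMean m δ Y.graph) _ _))
      refine stepMean_congr fun v _ l _ => ?_
      have h4 : (((Y.newBlock v l).size
          + ((Y.blocks.filter (¬ ·.Hit l)).map Block.size).sum : ℕ) : ℝ) = (j + 1 + 1 : ℕ) := by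
        rw [newBlock_size_add, hY.total_eq]
      simp only [Pi.add_apply, Pi.smul_apply, smul_eq_mul, hF₁, Multiset.sum_map_mul_right]
      push_cast [Nat.cast_multiset_sum, Multiset.map_map] at h4
      rw [← h4, add_mul]
      rfl
    rw [pow_succ, Module.End.mul_apply, h1, map_add, Pi.add_apply, ih F₂,
      pow_stepOp_congr hδ hX h2, ← ih F₃, ← Pi.add_apply, ← map_add,
      pow_stepOp_congr hδ hX h3, map_smul, Pi.smul_apply, smul_eq_mul]
    push_cast
    rfl

end History

/-! ### The likelihood ratio of one step -/

section Ratio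

variable {V : Type*} [DecidableEq V]

/-- The factor by which the weight of `l` changes when `D` is added to all weights. -/
noncomputable def ratio (D : ℝ) (a : V → ℝ) (l : List V) : ℝ :=
  wt (fun u => a u + D) l / wt a l

lemma ratio_cons (D : ℝ) (a : V → ℝ) (u : V) (l : List V) :
    ratio D a (u :: l) = (a u + D + l.count u) / (a u + l.count u) * ratio D a l := by
  rw [ratio, ratio, wt, wt, div_mul_div_comm]

lemma abs_factor_le {D α x : ℝ} (hα : 0 < α) (hx : α ≤ x) : |(x + D) / x| ≤ 1 + |D| / α := by
  have hx0 : 0 < x := hα.trans_le hx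
  rw [add_div, div_self hx0.ne']
  refine (abs_add_le _ _).trans ?_
  rw [abs_one, abs_div, abs_of_pos hx0]
  gcongr

lemma abs_factor_sub_le {D x y z : ℝ} (hz : 0 < z) (hx : z ≤ x) (hxy : x ≤ y) :
    |(x + D) / x - (y + D) / y| ≤ |D| / z := by
  have hx0 : 0 < x := hz.trans_le hx
  have hy0 : 0 < y := hx0.trans_le hxy
  have h : (x + D) / x - (y + D) / y = D * (1 / x - 1 / y) := by
    field_simp
    ring
  have h1 : 0 ≤ 1 / x - 1 / y := sub_nonneg.mpr (one_div_le_one_div_of_le hx0 hxy)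
  have h2 : 1 / x - 1 / y ≤ 1 / z := by
    have := one_div_le_one_div_of_le hz hx
    have : 0 < 1 / y := by positivity
    linarith
  rw [h, abs_mul, abs_of_nonneg h1, div_eq_mul_one_div |D|]
  gcongr

lemma abs_ratio_le {D α : ℝ} (hα : 0 < α) {a : V → ℝ} {l : List V} (ha : ∀ u ∈ l, α ≤ a u) :
    |ratio D a l| ≤ (1 + |D| / α) ^ l.length := by
  induction l with
  | nil => simp [ratio, wt]
  | cons u l ih =>
    simp only [List.mem_cons, forall_eq_or_imp] at ha
    rw [ratio_cons, abs_mul, List.length_cons, pow_succ', add_right_comm]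
    refine mul_le_mul (abs_factor_le hα ?_) (ih ha.2) (abs_nonneg _) (by positivity)
    have : (0 : ℝ) ≤ l.count u := by positivity
    linarith [ha.1]

/-- Larger weights at some targets change the ratio only a little, if the weights there are
large. -/
lemma abs_ratio_sub_le {D α : ℝ} (hα : 0 < α) {a b : V → ℝ} {e : V → ℝ} {l : List V}
    (ha : ∀ u ∈ l, α ≤ a u) (hab : ∀ u ∈ l, a u ≤ b u) (he0 : ∀ u ∈ l, 0 ≤ e u)
    (he : ∀ u ∈ l, a u ≠ b u → 1 ≤ e u) :
    |ratio D b l - ratio D a l|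
      ≤ (1 + |D| / α) ^ l.length * (l.map fun u => e u * (|D| / a u)).sum := by
  induction l with
  | nil => simp [ratio, wt]
  | cons u l ih =>
    simp only [List.mem_cons, forall_eq_or_imp] at ha hab he he0
    have hc : (0 : ℝ) ≤ l.count u := by positivity
    have hau : 0 < a u := hα.trans_le ha.1
    have hq : 1 ≤ 1 + |D| / α := by
      have : 0 ≤ |D| / α := by positivity
      linarith
    set q := 1 + |D| / α
    set S := (l.map fun u => e u * (|D| / a u)).sum with hS
    have hS0 : 0 ≤ S := List.sum_nonneg fun x hx => by
      obtain ⟨w, hw, rfl⟩ := List.mem_map.mp hx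
      have := hα.trans_le (ha.2 w hw)
      exact mul_nonneg (he0.2 w hw) (by positivity)
    set ra := (a u + D + l.count u) / (a u + l.count u)
    set rb := (b u + D + l.count u) / (b u + l.count u)
    have h1 : |rb - ra| ≤ e u * (|D| / a u) := by
      by_cases h : a u = b u
      · simp only [ra, rb, h, sub_self, abs_zero]
        rw [← h]
        exact mul_nonneg he0.1 (by positivity)
      · rw [abs_sub_comm]
        refine (?_ : _ ≤ |D| / a u).trans (le_mul_of_one_le_left (by positivity) (he.1 h))
        simp only [ra, rb]
        rw [add_right_comm (a u), add_right_comm (b u)]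
        exact abs_factor_sub_le hau (by linarith) (by linarith [hab.1])
    have h2 : |rb| ≤ q := by
      simp only [rb]
      rw [add_right_comm (b u)]
      exact abs_factor_le hα (by linarith [ha.1, hab.1])
    have h3 : |ratio D a l| ≤ q ^ l.length := abs_ratio_le hα ha.2
    have h4 : |ratio D b l - ratio D a l| ≤ q ^ l.length * S := ih ha.2 hab.2 he0.2 he.2
    have h5 : ratio D b (u :: l) - ratio D a (u :: l)
        = rb * (ratio D b l - ratio D a l) + (rb - ra) * ratio D a l := by
      rw [ratio_cons, ratio_cons]
      ring
    have h6 : 0 ≤ e u * (|D| / a u) := mul_nonneg he0.1 (by positivity)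
    rw [h5, List.map_cons, List.sum_cons, List.length_cons, pow_succ']
    refine (abs_add_le _ _).trans ?_
    rw [abs_mul, abs_mul]
    calc |rb| * |ratio D b l - ratio D a l| + |rb - ra| * |ratio D a l|
        ≤ q * (q ^ l.length * S) + e u * (|D| / a u) * q ^ l.length := by gcongr
      _ ≤ q * (q ^ l.length * S) + e u * (|D| / a u) * (q * q ^ l.length) := by
          gcongr
          exact le_mul_of_one_le_left (by positivity) hq
      _ = q * q ^ l.length * (e u * (|D| / a u) + S) := by ring

/-- The quotient of the normalizing constants for the shifts `δ` and `δ'` of a step from a graph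
with `s` vertices. -/
noncomputable def normRatio (m : ℕ) (δ δ' : ℝ) (s : ℕ) : ℝ :=
  pz (2 * m * (s - 1) + s * δ) m / pz (2 * m * (s - 1) + s * δ') m

lemma abs_normRatio_le {m : ℕ} {δ δ' : ℝ} (hδ' : -(m : ℝ) < δ') {s : ℕ} (hs : 2 ≤ s) :
    |normRatio m δ δ' s| ≤ (1 + |δ - δ'| / (m + δ')) ^ m := by
  have hs' : (2 : ℝ) ≤ s := by exact_mod_cast hs
  have hα : 0 < m + δ' := by linarith
  have hm : (0 : ℝ) ≤ m := Nat.cast_nonneg _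
  rw [normRatio, pz, pz, ← Finset.prod_div_distrib, Finset.abs_prod]
  refine (Finset.prod_le_prod (g := fun _ => 1 + |δ - δ'| / (m + δ')) (fun _ _ => abs_nonneg _)
    fun j _ => ?_).trans_eq (by rw [Finset.prod_const, Finset.card_range])
  have h1 : (2 * m * (s - 1) + s * δ + j : ℝ) = 2 * m * (s - 1) + s * δ' + j + s * (δ - δ') := by
    ring
  have h2 : (s : ℝ) * (m + δ') ≤ 2 * m * (s - 1) + s * δ' + j := by
    have : (0 : ℝ) ≤ j := by positivity
    nlinarith
  rw [h1]
  refine (abs_factor_le (by positivity) h2).trans_eq ?_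
  rw [abs_mul, abs_of_nonneg (by linarith : (0 : ℝ) ≤ s), mul_div_mul_left _ _ (by linarith)]

/-- The relative change of the likelihood of the graph `G` if its last vertex has the list of
targets `l` and the shift `δ'` instead of `δ` is used in the last step; `c` stands for the
quotient of the normalizing constants. The expression makes sense for all vertices whose targets
have the right degrees, and it is used for the last vertices of all blocks. -/
noncomputable def score (δ δ' c : ℝ) (G : PAMultigraph V) (l : List V) : ℝ :=
  c * ratio (δ' - δ) (fun u => G.shift δ u - l.count u) l - 1

lemma score_attach {m : ℕ} {δ δ' c : ℝ} {G : PAMultigraph V} {v : V} {l : List V}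
    (hv : v ∉ G.verts) (hl : l ∈ lists G.verts m) :
    score δ δ' c (G.attach v l) l = c * (wt (G.shift δ') l / wt (G.shift δ) l) - 1 := by
  have h : ∀ (δ : ℝ), ∀ u ∈ l, (G.attach v l).shift δ u - l.count u = G.shift δ u := by
    intro δ u hu
    simp only [PAMultigraph.shift]
    rw [deg_attach_of_ne G (ne_of_mem_lists hv hl u hu)]
    push_cast
    ring
  rw [score, ratio, wt_congr (a := fun u => (G.attach v l).shift δ u - l.count u) (h δ),
    wt_congr (b := G.shift δ') fun u hu => ?_]
  rw [h δ u hu, PAMultigraph.shift, PAMultigraph.shift]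
  ring

lemma att_mul_score {m : ℕ} {δ δ' : ℝ} (hδ : -(m : ℝ) < δ) {G : PAMultigraph V}
    (hG : Good m G) {v : V} {l : List V} (hv : v ∉ G.verts) (hl : l ∈ lists G.verts m) :
    att (G.shift δ) G.verts m l * score δ δ' (normRatio m δ δ' G.verts.card) (G.attach v l) l
      = att (G.shift δ') G.verts m l - att (G.shift δ) G.verts m l := by
  have hw : wt (G.shift δ) l ≠ 0 := (wt_pos fun u hu => by
    have : (m : ℝ) ≤ G.deg u := by exact_mod_cast hG.le_deg u ((mem_lists.mp hl).2 u hu)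
    simp only [PAMultigraph.shift]
    linarith).ne'
  have hp : pz (∑ u ∈ G.verts, G.shift δ u) m ≠ 0 := (pz_pos (hG.sum_shift_pos hδ) m).ne'
  rw [score_attach hv hl, att, att, normRatio, ← hG.sum_shift, ← hG.sum_shift]
  field_simp

variable [Fintype V]

lemma stepMean_score_mul {m : ℕ} {δ δ' : ℝ} (hδ : -(m : ℝ) < δ) {G : PAMultigraph V}
    (hG : Good m G) (F : V → List V → ℝ) :
    stepMean m δ G (fun v l => score δ δ' (normRatio m δ δ' G.verts.card) (G.attach v l) l * F v l)
      = stepMean m δ' G F - stepMean m δ G F := by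
  simp only [stepMean_apply]
  rw [← Finset.sum_sub_distrib]
  refine Finset.sum_congr rfl fun v hv => ?_
  rw [← mul_sub, ← Finset.sum_sub_distrib]
  congr 1
  refine Finset.sum_congr rfl fun l hl => ?_
  rw [← mul_assoc, att_mul_score hδ hG (mem_free.mp hv) hl, sub_mul]

end Ratio

/-! ### Moments of the blocks -/

section Moments

variable {V : Type*} [DecidableEq V]

lemma sum_mul_multiset_sum {V α : Type*} (S : Finset V) (g : V → ℝ) (M : Multiset α)
    (f : α → V → ℝ) :
    ∑ u ∈ S, g u * (M.map fun B => f B u).sum = (M.map fun B => ∑ u ∈ S, g u * f B u).sum := by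
  simp only [← Multiset.sum_map_mul_left]
  exact (Multiset.sum_map_sum_map _ _).symm

lemma newBlock_size_le (X : History V) (v : V) (l : List V) :
    ((X.newBlock v l).size : ℝ) ≤ 1 + (l.map fun u =>
      (X.blocks.map fun B => if u ∈ B.verts then (B.size : ℝ) else 0).sum).sum := by
  have h1 : ((X.newBlock v l).size : ℝ)
      = 1 + (X.blocks.map fun B => if B.Hit l then (B.size : ℝ) else 0).sum := by
    rw [History.newBlock, ← sum_map_filter]
    push_cast [Nat.cast_multiset_sum, Multiset.map_map]
    rfl
  rw [h1, add_le_add_iff_left]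
  clear h1
  induction l with
  | nil => simp [Block.Hit]
  | cons u l ih =>
    rw [List.map_cons, List.sum_cons]
    refine le_trans ?_ (add_le_add_right ih _)
    rw [← Multiset.sum_map_add]
    refine Multiset.sum_map_le_sum_map _ _ fun B _ => ?_
    have h : B.Hit (u :: l) ↔ u ∈ B.verts ∨ B.Hit l := by simp [Block.Hit]
    have h0 : (0 : ℝ) ≤ B.size := Nat.cast_nonneg _
    rw [if_congr h rfl rfl]
    by_cases hu : u ∈ B.verts
    · rw [if_pos (Or.inl hu), if_pos hu]
      exact le_add_of_nonneg_right (by split_ifs <;> simp)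
    · rw [if_neg hu, zero_add]
      simp only [hu, false_or, le_refl]

variable [Fintype V]

lemma pow_stepOp_const {m s : ℕ} {δ : ℝ} (hδ : -(m : ℝ) < δ) (c : ℝ) (j : ℕ) :
    ∀ {i : ℕ} {X : History V}, Valid m s i X → s + i + j ≤ Fintype.card V →
      (stepOp m δ ^ j) (fun _ => c) X = c := by
  induction j with
  | zero => intro i X _ _; rfl
  | succ j ih =>
    intro i X hX h
    rw [pow_succ', Module.End.mul_apply]
    refine Eq.trans (stepMean_congr fun v hv l hl => ih (hX.step hv hl) (by omega))
      (stepMean_const hδ hX.good ?_ c)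
    rw [hX.card_eq]
    omega

/-- A recent block is hit with probability at most proportional to its size. -/
lemma newMean_size_le {m s j : ℕ} {δ : ℝ} (hδ : -(m : ℝ) < δ) {X : History V}
    (hX : Valid m s j X) (hc : s + j < Fintype.card V) (hs : 0 < s) :
    newMean m δ (fun _ B => (B.size : ℝ)) X
      ≤ 1 + m * (3 * m + δ) / (m + δ) / s * blockSum (fun _ B => (B.size : ℝ)) X := by
  have hα : 0 < m + δ := by linarith
  have hcard : X.graph.verts.card < Fintype.card V := by rw [hX.card_eq]; exact hc
  set h : V → ℝ := fun u => (X.blocks.map fun B => if u ∈ B.verts then (B.size : ℝ) else 0).sum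
    with hh
  have hh0 : ∀ u, 0 ≤ h u := fun u => Multiset.sum_nonneg fun x hx => by
    obtain ⟨B, -, rfl⟩ := Multiset.mem_map.mp hx
    positivity
  have h1 : newMean m δ (fun _ B => (B.size : ℝ)) X
      ≤ 1 + stepMean m δ X.graph (fun _ l => (l.map h).sum) := by
    rw [← stepMean_const hδ hX.good hcard 1]
    refine le_trans (stepMean_mono hδ hX.good fun v hv l hl => newBlock_size_le X v l)
      (map_add (stepMean m δ X.graph) _ _).le
  have h2 : ∑ u ∈ X.graph.verts, (X.graph.shift δ u + m) * h u
      ≤ (3 * m + δ) * blockSum (fun _ B => (B.size : ℝ)) X := by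
    rw [hh, sum_mul_multiset_sum, blockSum, ← Multiset.sum_map_mul_left]
    refine Multiset.sum_map_le_sum_map _ _ fun B hB => ?_
    have h3 : ∑ u ∈ X.graph.verts,
          (X.graph.shift δ u + m) * (if u ∈ B.verts then (B.size : ℝ) else 0)
        = (∑ u ∈ B.verts, (X.graph.shift δ u + m)) * B.size := by
      rw [Finset.sum_mul, ← Finset.sum_filter_add_sum_filter_not X.graph.verts (· ∈ B.verts),
        Finset.filter_mem_eq_inter, Finset.inter_eq_right.mpr (hX.subset B hB)]
      rw [Finset.sum_congr rfl fun u hu => by rw [if_pos hu], add_eq_left]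
      exact Finset.sum_eq_zero fun u hu => by rw [if_neg (Finset.mem_filter.mp hu).2, mul_zero]
    have h4 : ∑ u ∈ B.verts, (X.graph.shift δ u + m) ≤ (3 * m + δ) * B.size := by
      have h5 : ((∑ u ∈ B.verts, X.graph.deg u : ℕ) : ℝ) ≤ (2 * m * B.size : ℕ) := by
        exact_mod_cast hX.sum_deg_le B hB
      have h6 : (B.verts.card : ℝ) ≤ B.size := by exact_mod_cast hX.card_le B hB
      simp only [PAMultigraph.shift, add_assoc, Finset.sum_add_distrib, Finset.sum_const,
        nsmul_eq_mul, ← mul_add]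
      push_cast at h5
      nlinarith
    rw [h3, ← mul_assoc]
    exact mul_le_mul_of_nonneg_right h4 (Nat.cast_nonneg _)
  have hs' : (0 : ℝ) < s := by exact_mod_cast hs
  have h7 : s * (m + δ) ≤ ∑ u ∈ X.graph.verts, X.graph.shift δ u := by
    refine le_trans ?_ (hX.good.le_sum_shift δ)
    rw [hX.card_eq]
    push_cast
    gcongr
    simp
  refine h1.trans ?_
  rw [add_le_add_iff_left]
  refine (stepMean_map_sum_le hδ hX.good hcard fun u _ => hh0 u).trans ?_
  have h8 : 0 ≤ ∑ u ∈ X.graph.verts, (X.graph.shift δ u + m) * h u :=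
    Finset.sum_nonneg fun u hu => mul_nonneg
      (add_nonneg (hX.good.shift_nonneg hδ u hu) (Nat.cast_nonneg _)) (hh0 u)
  calc m * ((∑ u ∈ X.graph.verts, (X.graph.shift δ u + m) * h u)
        / ∑ u ∈ X.graph.verts, X.graph.shift δ u)
      ≤ m * (((3 * m + δ) * blockSum (fun _ B => (B.size : ℝ)) X) / (s * (m + δ))) := by
        gcongr
        exact h8.trans h2
    _ = _ := by field_simp

/-- In a window that is short compared with `s`, the expected size of the newest block is at most
`2`: by the exchange identity it satisfies a linear recursion. -/
lemma pow_stepOp_newMean_size_le {m s : ℕ} {δ : ℝ} (hδ : -(m : ℝ) < δ) {X : History V}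
    (hX : Valid m s 0 X) (hX0 : X.blocks = 0) (hs : 0 < s) (j : ℕ)
    (hc : s + j < Fintype.card V) (hj : 2 * (m * (3 * m + δ) / (m + δ)) * j ≤ s) :
    (stepOp m δ ^ j) (newMean m δ fun _ B => (B.size : ℝ)) X ≤ 2 := by
  have hα : 0 < m + δ := by linarith
  have hs' : (0 : ℝ) < s := by exact_mod_cast hs
  set K := m * (3 * m + δ) / (m + δ) with hK
  have hK0 : 0 ≤ K := by
    have : 0 ≤ 3 * m + δ := by linarith [(Nat.cast_nonneg m : (0 : ℝ) ≤ m)]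
    positivity
  induction j with
  | zero =>
    refine (newMean_size_le hδ hX hc hs).trans ?_
    simp [blockSum, hX0]
  | succ j ih =>
    have hj' : 2 * K * j ≤ s := by
      refine le_trans ?_ hj
      gcongr
      simp
    have h1 : (stepOp m δ ^ (j + 1)) (newMean m δ fun _ B => (B.size : ℝ)) X
        ≤ (stepOp m δ ^ (j + 1)) ((fun _ => 1) + (K / s) • blockSum fun _ B => (B.size : ℝ)) X := by
      refine pow_stepOp_mono hδ _ hX fun Y hY => ?_
      rw [zero_add] at hY
      exact newMean_size_le hδ hY hc hs
    rw [map_add, map_smul, Pi.add_apply, Pi.smul_apply, smul_eq_mul,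
      pow_stepOp_const hδ _ _ hX (by omega), pow_stepOp_blockSum hδ hX hX0] at h1
    have h2 := ih (by omega) hj'
    have h3 : K / s * (((j : ℝ) + 1) * 2) ≤ 1 := by
      rw [div_mul_eq_mul_div, div_le_one hs']
      push_cast at hj
      linarith
    have h4 : K / s * (((j : ℝ) + 1)
        * (stepOp m δ ^ j) (newMean m δ fun _ B => (B.size : ℝ)) X)
        ≤ K / s * (((j : ℝ) + 1) * 2) := by
      gcongr
    linarith

end Moments

/-! ### The second moment of the score -/

section SecondMoment

lemma sum_map_count_mul {V : Type*} [DecidableEq V] (T l : List V) (g : V → ℝ) :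
    (T.map fun u => l.count u * g u).sum = (l.map fun w => T.count w * g w).sum := by
  induction l with
  | nil => simp
  | cons w l ih =>
    rw [List.map_cons, List.sum_cons, ← ih]
    clear ih
    induction T with
    | nil => simp
    | cons u T ih =>
      rw [List.map_cons, List.sum_cons, ih, List.map_cons, List.sum_cons, List.count_cons,
        List.count_cons]
      simp only [beq_iff_eq]
      by_cases h : w = u
      · subst h; simp; ring
      · rw [if_neg h, if_neg (Ne.symm h)]; simp; ring

variable {V : Type*} [DecidableEq V]

/-- A uniform bound for the likelihood ratio of one step. -/
noncomputable def ratioBound (m : ℕ) (δ δ' : ℝ) : ℝ :=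
  (1 + |δ - δ'| / (m + δ')) ^ m * (1 + |δ' - δ| / (m + δ)) ^ m

lemma ratioBound_nonneg {m : ℕ} {δ δ' : ℝ} (hδ : -(m : ℝ) < δ) (hδ' : -(m : ℝ) < δ') :
    0 ≤ ratioBound m δ δ' := by
  have : 0 < m + δ := by linarith
  have : 0 < m + δ' := by linarith
  rw [ratioBound]
  positivity

lemma abs_score_le {m : ℕ} {δ δ' : ℝ} (hδ : -(m : ℝ) < δ) (hδ' : -(m : ℝ) < δ') {s : ℕ}
    (hs : 2 ≤ s) {G : PAMultigraph V} {l : List V} (hl : l.length = m)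
    (hc : ∀ u ∈ l, m + l.count u ≤ G.deg u) :
    |score δ δ' (normRatio m δ δ' s) G l| ≤ ratioBound m δ δ' + 1 := by
  have hα : 0 < m + δ := by linarith
  have hα' : 0 < m + δ' := by linarith
  rw [score]
  refine (abs_sub _ _).trans ?_
  rw [abs_mul, abs_one, ratioBound]
  gcongr
  · exact abs_normRatio_le hδ' hs
  · refine (abs_ratio_le hα fun u hu => ?_).trans_eq (by rw [hl])
    have : ((m + l.count u : ℕ) : ℝ) ≤ G.deg u := by exact_mod_cast hc u hu
    push_cast at this
    simp only [PAMultigraph.shift]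
    linarith

/-- The sensitivity of the score of the target list `T` to an additional edge at `w`. -/
noncomputable def sens (δ δ' : ℝ) (G : PAMultigraph V) (T : List V) (w : V) : ℝ :=
  T.count w * (|δ' - δ| / (G.shift δ w - T.count w))

variable {m s j : ℕ} {δ δ' : ℝ} {X : History V}

lemma Valid.le_shift_sub (hX : Valid m s j X) {B : Block V} (hB : B ∈ X.blocks) {u : V}
    (hu : u ∈ B.targets) (δ : ℝ) : m + δ ≤ X.graph.shift δ u - B.targets.count u := by
  have h : ((m + B.targets.count u : ℕ) : ℝ) ≤ X.graph.deg u := by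
    exact_mod_cast hX.count_le B hB u hu
  push_cast at h
  simp only [PAMultigraph.shift]
  linarith

lemma Valid.sens_nonneg (hδ : -(m : ℝ) < δ) (hX : Valid m s j X) {B : Block V}
    (hB : B ∈ X.blocks) (w : V) : 0 ≤ sens δ δ' X.graph B.targets w := by
  rw [sens]
  by_cases hw : w ∈ B.targets
  · have := hX.le_shift_sub hB hw δ
    have : 0 < X.graph.shift δ w - B.targets.count w := by linarith
    positivity
  · rw [List.count_eq_zero.mpr hw, Nat.cast_zero, zero_mul]

lemma Valid.abs_score_sub_le (hδ : -(m : ℝ) < δ) (hδ' : -(m : ℝ) < δ') (hX : Valid m s j X)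
    {t : ℕ} (ht : 2 ≤ t) {B : Block V} (hB : B ∈ X.blocks) {v : V} {l : List V}
    (hv : v ∉ X.graph.verts) :
    |score δ δ' (normRatio m δ δ' t) (X.graph.attach v l) B.targets
        - score δ δ' (normRatio m δ δ' t) X.graph B.targets|
      ≤ ratioBound m δ δ' * (l.map (sens δ δ' X.graph B.targets)).sum := by
  have hα : 0 < m + δ := by linarith
  have hdeg : ∀ u ∈ B.targets, (X.graph.attach v l).shift δ u = X.graph.shift δ u + l.count u := by
    intro u hu
    have : u ≠ v := fun h => hv (h ▸ hX.target_mem B hB u hu)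
    simp only [PAMultigraph.shift]
    rw [deg_attach_of_ne _ this]
    push_cast
    ring
  have h1 := abs_ratio_sub_le (D := δ' - δ) (l := B.targets) hα
    (a := fun u => X.graph.shift δ u - B.targets.count u)
    (b := fun u => (X.graph.attach v l).shift δ u - B.targets.count u)
    (e := fun u => l.count u) (fun u hu => hX.le_shift_sub hB hu δ)
    (fun u hu => by simp [hdeg u hu]) (fun u _ => Nat.cast_nonneg _) (fun u hu h => by
      rw [hdeg u hu] at h
      have : l.count u ≠ 0 := fun h0 => h (by simp [h0])
      exact_mod_cast Nat.one_le_iff_ne_zero.mpr this)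
  rw [sum_map_count_mul, hX.length_eq B hB] at h1
  have h2 : ∀ x y z : ℝ, z * x - 1 - (z * y - 1) = z * (x - y) := fun x y z => by ring
  have h3 := abs_normRatio_le (δ := δ) hδ' ht
  rw [score, score, h2, abs_mul, ratioBound, mul_assoc]
  exact mul_le_mul h3 h1 (abs_nonneg _) ((abs_nonneg _).trans h3)

lemma Valid.sum_sens_le (hδ : -(m : ℝ) < δ) (hX : Valid m s j X) {B : Block V}
    (hB : B ∈ X.blocks) :
    ∑ w ∈ X.graph.verts, (X.graph.shift δ w + m) * sens δ δ' X.graph B.targets w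
      ≤ m * (|δ' - δ| * (1 + 2 * m / (m + δ))) := by
  have hα : 0 < m + δ := by linarith
  have hT : B.targets ∈ lists X.graph.verts m :=
    mem_lists.mpr ⟨hX.length_eq B hB, hX.target_mem B hB⟩
  refine le_of_le_of_eq (Finset.sum_le_sum (g := fun w => (B.targets.count w : ℝ)
    * (|δ' - δ| * (1 + 2 * m / (m + δ)))) fun w _ => ?_)
    (by rw [← Finset.sum_mul, sum_count_lists hT])
  rw [sens, mul_left_comm]
  by_cases hw : w ∈ B.targets
  · have h1 := hX.le_shift_sub hB hw δ
    have h2 : (B.targets.count w : ℝ) ≤ m := by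
      have := B.targets.count_le_length (a := w)
      rw [hX.length_eq B hB] at this
      exact_mod_cast this
    set x := X.graph.shift δ w - B.targets.count w with hx
    have hx0 : 0 < x := hα.trans_le h1
    have h3 : X.graph.shift δ w + m ≤ x + 2 * m := by linarith
    refine mul_le_mul_of_nonneg_left ?_ (Nat.cast_nonneg _)
    rw [mul_div_assoc', mul_comm, mul_div_assoc]
    refine mul_le_mul_of_nonneg_left ?_ (abs_nonneg _)
    refine (div_le_div_of_nonneg_right h3 hx0.le).trans ?_
    rw [add_div, div_self hx0.ne']
    gcongr
  · rw [List.count_eq_zero.mpr hw, Nat.cast_zero, zero_mul, zero_mul]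

/-- The sum of the scores of all recent vertices, as they would be if each was the last one. -/
noncomputable def scoreSum (δ δ' c : ℝ) : History V → ℝ :=
  blockSum fun X B => score δ δ' c X.graph B.targets

lemma Valid.scoreSum_step_le (hδ : -(m : ℝ) < δ) (hδ' : -(m : ℝ) < δ') (hX : Valid m s j X)
    {t : ℕ} (ht : 2 ≤ t) {v : V} {l : List V} (hv : v ∉ X.graph.verts)
    (hl : l ∈ lists X.graph.verts m) :
    |scoreSum δ δ' (normRatio m δ δ' t) (X.step v l) - scoreSum δ δ' (normRatio m δ δ' t) X|
      ≤ 2 * (ratioBound m δ δ' + 1) * (X.newBlock v l).size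
        + ratioBound m δ δ' * (X.blocks.map fun B =>
            B.size * (l.map (sens δ δ' X.graph B.targets)).sum).sum := by
  set c := normRatio m δ δ' t with hc
  set R := ratioBound m δ δ' with hR
  have hR0 : 0 ≤ R := ratioBound_nonneg hδ hδ'
  have hY := hX.step hv hl
  have h1 : scoreSum δ δ' c (X.step v l) - scoreSum δ δ' c X
      = (X.newBlock v l).size * score δ δ' c (X.graph.attach v l) l
        + (X.blocks.map fun B => (if ¬ B.Hit l then
            B.size * score δ δ' c (X.graph.attach v l) B.targets else 0)
            - B.size * score δ δ' c X.graph B.targets).sum := by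
    rw [Multiset.sum_map_sub, ← sum_map_filter, ← add_sub_assoc]
    congr 1
    rw [scoreSum, blockSum, blocks_step, Multiset.map_cons, Multiset.sum_cons]
    rfl
  have h2 : |((X.newBlock v l).size : ℝ) * score δ δ' c (X.graph.attach v l) l|
      ≤ (R + 1) * (X.newBlock v l).size := by
    rw [abs_mul, mul_comm, Nat.abs_cast]
    gcongr
    have hmem : X.newBlock v l ∈ (X.step v l).blocks := Multiset.mem_cons_self _ _
    exact abs_score_le hδ hδ' ht (hY.length_eq _ hmem) (hY.count_le _ hmem)
  have h3 : (X.blocks.map fun B => if B.Hit l then (B.size : ℝ) else 0).sum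
      ≤ (X.newBlock v l).size := by
    rw [History.newBlock, ← sum_map_filter]
    push_cast [Nat.cast_multiset_sum, Multiset.map_map]
    exact le_add_of_nonneg_left zero_le_one
  have h4 : |(X.blocks.map fun B => (if ¬ B.Hit l then
            B.size * score δ δ' c (X.graph.attach v l) B.targets else 0)
            - B.size * score δ δ' c X.graph B.targets).sum|
      ≤ (R + 1) * (X.newBlock v l).size
        + R * (X.blocks.map fun B =>
            B.size * (l.map (sens δ δ' X.graph B.targets)).sum).sum := by
    refine Multiset.abs_sum_le_sum_abs.trans ?_
    rw [Multiset.map_map]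
    refine le_trans ?_ (add_le_add_left (mul_le_mul_of_nonneg_left h3 (by positivity)) _)
    rw [← Multiset.sum_map_mul_left, ← Multiset.sum_map_mul_left, ← Multiset.sum_map_add]
    refine Multiset.sum_map_le_sum_map _ _ fun B hB => ?_
    have hs0 : 0 ≤ (l.map (sens δ δ' X.graph B.targets)).sum := List.sum_nonneg fun x hx => by
      obtain ⟨w, -, rfl⟩ := List.mem_map.mp hx
      exact hX.sens_nonneg hδ hB w
    have hB0 : (0 : ℝ) ≤ B.size := Nat.cast_nonneg _
    simp only [Function.comp_apply]
    by_cases h : B.Hit l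
    · have h5 := abs_score_le hδ hδ' ht (hX.length_eq _ hB) (hX.count_le _ hB)
      rw [if_neg (not_not_intro h), if_pos h, zero_sub, abs_neg, abs_mul, Nat.abs_cast]
      have : B.size * |score δ δ' c X.graph B.targets| ≤ B.size * (R + 1) := by gcongr
      have : 0 ≤ R * (B.size * (l.map (sens δ δ' X.graph B.targets)).sum) := by positivity
      linarith
    · have h5 := hX.abs_score_sub_le hδ hδ' ht hB hv (l := l)
      rw [if_pos h, if_neg h, mul_zero, zero_add, ← mul_sub, abs_mul, Nat.abs_cast, mul_left_comm]
      gcongr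
  rw [h1]
  refine (abs_add_le _ _).trans ((add_le_add h2 h4).trans_eq ?_)
  ring

variable [Fintype V]

/-- The constant in the bound for the mean effect of one step on the scores of the other blocks. -/
noncomputable def driftBound (m : ℕ) (δ δ' : ℝ) : ℝ :=
  ratioBound m δ δ' * (m * (m * (|δ' - δ| * (1 + 2 * m / (m + δ)))) / (m + δ))

lemma driftBound_nonneg (hδ : -(m : ℝ) < δ) (hδ' : -(m : ℝ) < δ') :
    0 ≤ driftBound m δ δ' := by
  have hα : 0 < m + δ := by linarith
  have := ratioBound_nonneg hδ hδ'
  rw [driftBound]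
  positivity

lemma Valid.stepMean_sens_le (hδ : -(m : ℝ) < δ) (hδ' : -(m : ℝ) < δ') (hX : Valid m s j X)
    (hc : s + j < Fintype.card V) (hs : 0 < s) (hj : j ≤ s) :
    ratioBound m δ δ' * stepMean m δ X.graph (fun _ l => (X.blocks.map fun B =>
            B.size * (l.map (sens δ δ' X.graph B.targets)).sum).sum) ≤ driftBound m δ δ' := by
  have hα : 0 < m + δ := by linarith
  have hs' : (0 : ℝ) < s := by exact_mod_cast hs
  have hZ : s * (m + δ) ≤ ∑ u ∈ X.graph.verts, X.graph.shift δ u := by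
    refine le_trans ?_ (hX.good.le_sum_shift δ)
    rw [hX.card_eq]
    push_cast
    gcongr
    simp
  set E := m * (|δ' - δ| * (1 + 2 * m / (m + δ))) with hE
  have hE0 : 0 ≤ E := by positivity
  rw [driftBound]
  refine mul_le_mul_of_nonneg_left ?_ (ratioBound_nonneg hδ hδ')
  rw [stepMean_multiset_sum]
  have h1 : ∀ B ∈ X.blocks, stepMean m δ X.graph (fun _ l =>
        B.size * (l.map (sens δ δ' X.graph B.targets)).sum)
      ≤ B.size * (m * (E / (s * (m + δ)))) := by
    intro B hB
    have h2 := map_smul (stepMean m δ X.graph) (B.size : ℝ)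
      fun _ l => (l.map (sens δ δ' X.graph B.targets)).sum
    rw [smul_eq_mul] at h2
    refine h2.trans_le ?_
    gcongr
    refine (stepMean_map_sum_le hδ hX.good (by rw [hX.card_eq]; exact hc)
      fun u _ => hX.sens_nonneg hδ hB u).trans ?_
    gcongr
    exact hX.sum_sens_le hδ hB
  refine (Multiset.sum_map_le_sum_map _ _ h1).trans ?_
  have h2 : (X.blocks.map fun B => (B.size : ℝ)).sum = j := by
    rw [← hX.total_eq, History.total]
    push_cast [Nat.cast_multiset_sum, Multiset.map_map]
    rfl
  rw [Multiset.sum_map_mul_right, h2]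
  have h3 : (j : ℝ) / s ≤ 1 := by
    rw [div_le_one hs']
    exact_mod_cast hj
  calc (j : ℝ) * (m * (E / (s * (m + δ)))) = j / s * (m * E / (m + δ)) := by field_simp
    _ ≤ 1 * (m * E / (m + δ)) := by gcongr
    _ = _ := one_mul _

/-- The score of the last vertex is centred given the past, so that only the change of the sum of
the scores in the last step contributes. -/
lemma Valid.newMean_score_mul_scoreSum_le (hδ : -(m : ℝ) < δ) (hδ' : -(m : ℝ) < δ')
    (hX : Valid m s j X) (hc : s + j < Fintype.card V) (hs : 2 ≤ s) (hj : j ≤ s) :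
    newMean m δ (fun Y B => score δ δ' (normRatio m δ δ' (s + j)) Y.graph B.targets
        * scoreSum δ δ' (normRatio m δ δ' (s + j)) Y) X
      ≤ (ratioBound m δ δ' + 1) * (2 * (ratioBound m δ δ' + 1)
          * newMean m δ (fun _ B => (B.size : ℝ)) X + driftBound m δ δ') := by
  set c := normRatio m δ δ' (s + j) with hcdef
  set R := ratioBound m δ δ' with hR
  have hR0 : 0 ≤ R := ratioBound_nonneg hδ hδ'
  have hcard : X.graph.verts.card < Fintype.card V := by rw [hX.card_eq]; exact hc
  set S : V → List V → ℝ := fun _ l => (X.blocks.map fun B =>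
            B.size * (l.map (sens δ δ' X.graph B.targets)).sum).sum with hS
  set N : V → List V → ℝ := fun v l => (X.newBlock v l).size with hN
  set P : V → List V → ℝ := fun v l =>
    score δ δ' c (X.graph.attach v l) l * scoreSum δ δ' c X with hP
  have h0 : stepMean m δ X.graph P = 0 := by
    have := stepMean_score_mul (δ' := δ') hδ hX.good fun _ _ => scoreSum δ δ' c X
    rw [hX.card_eq] at this
    rw [hP, this, stepMean_const hδ hX.good hcard, stepMean_const hδ' hX.good hcard, sub_self]
  have h1 : newMean m δ (fun Y B => score δ δ' c Y.graph B.targets * scoreSum δ δ' c Y) X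
      ≤ stepMean m δ X.graph (P + (R + 1) • ((2 * (R + 1)) • N + R • S)) := by
    refine stepMean_mono hδ hX.good fun v hv l hl => ?_
    have hY := hX.step hv hl
    have hmem : X.newBlock v l ∈ (X.step v l).blocks := Multiset.mem_cons_self _ _
    have h2 : |score δ δ' c (X.graph.attach v l) l| ≤ R + 1 :=
      abs_score_le hδ hδ' (by omega) (hY.length_eq _ hmem) (hY.count_le _ hmem)
    have h3 := hX.scoreSum_step_le hδ hδ' (t := s + j) (by omega) hv hl
    simp only [Pi.add_apply, Pi.smul_apply, smul_eq_mul, hP, hN, hS]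
    have h4 : score δ δ' c (X.graph.attach v l) l * (scoreSum δ δ' c (X.step v l)
        - scoreSum δ δ' c X) ≤ (R + 1) * |scoreSum δ δ' c (X.step v l) - scoreSum δ δ' c X| := by
      refine (le_abs_self _).trans ?_
      rw [abs_mul]
      gcongr
    have h5 := mul_le_mul_of_nonneg_left h3 (by positivity : 0 ≤ R + 1)
    have h6 : score δ δ' c (X.step v l).graph (X.newBlock v l).targets
          * scoreSum δ δ' c (X.step v l)
        = score δ δ' c (X.graph.attach v l) l * scoreSum δ δ' c X
          + score δ δ' c (X.graph.attach v l) l * (scoreSum δ δ' c (X.step v l)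
            - scoreSum δ δ' c X) := by
      rw [← mul_add, add_sub_cancel]
      rfl
    rw [h6, add_le_add_iff_left]
    exact h4.trans h5
  refine h1.trans ?_
  rw [map_add, h0, zero_add, map_smul, map_add, map_smul, map_smul]
  simp only [smul_eq_mul]
  have h7 := hX.stepMean_sens_le hδ hδ' hc (by omega) hj
  gcongr
  rfl

end SecondMoment

/-! ### The effect of a different shift in one late step -/

section LateStep

variable {V : Type*} [DecidableEq V] [Fintype V] {m s : ℕ} {δ δ' : ℝ}

/-- A bound for the second moment of the sum of the scores, per recent vertex. -/
noncomputable def momentBound (m : ℕ) (δ δ' : ℝ) : ℝ :=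
  (ratioBound m δ δ' + 1) * (2 * (ratioBound m δ δ' + 1) * 2 + driftBound m δ δ')

lemma momentBound_nonneg (hδ : -(m : ℝ) < δ) (hδ' : -(m : ℝ) < δ') : 0 ≤ momentBound m δ δ' := by
  have := ratioBound_nonneg hδ hδ'
  have := driftBound_nonneg hδ hδ'
  rw [momentBound]
  positivity

lemma pow_stepOp_scoreSum_sq_le (hδ : -(m : ℝ) < δ) (hδ' : -(m : ℝ) < δ') {X : History V}
    (hX : Valid m s 0 X) (hX0 : X.blocks = 0) (hs : 2 ≤ s) {j : ℕ} (hc : s + j < Fintype.card V)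
    (hj : j ≤ s) (hK : 2 * (m * (3 * m + δ) / (m + δ)) * j ≤ s) :
    (stepOp m δ ^ (j + 1)) (fun Y => scoreSum δ δ' (normRatio m δ δ' (s + j)) Y ^ 2) X
      ≤ (j + 1) * momentBound m δ δ' := by
  set c := normRatio m δ δ' (s + j) with hcdef
  set R := ratioBound m δ δ' with hR
  have hR0 : 0 ≤ R := ratioBound_nonneg hδ hδ'
  have h1 : (fun Y => scoreSum δ δ' c Y ^ 2) = blockSum (V := V) fun Y B =>
      score δ δ' c Y.graph B.targets * scoreSum δ δ' c Y := by
    ext Y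
    rw [blockSum, sq, scoreSum, blockSum, ← Multiset.sum_map_mul_right]
    simp only [mul_assoc]
  rw [h1, pow_stepOp_blockSum hδ hX hX0]
  refine mul_le_mul_of_nonneg_left ?_ (by positivity)
  have h2 : (stepOp m δ ^ j) (newMean m δ fun Y B =>
        score δ δ' c Y.graph B.targets * scoreSum δ δ' c Y) X
      ≤ (stepOp m δ ^ j) (((R + 1) * (2 * (R + 1))) • newMean m δ (fun _ B => (B.size : ℝ))
          + fun _ => (R + 1) * driftBound m δ δ') X := by
    refine pow_stepOp_mono hδ j hX fun Y hY => ?_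
    rw [zero_add] at hY
    refine (hY.newMean_score_mul_scoreSum_le hδ hδ' hc hs hj).trans_eq ?_
    simp only [Pi.add_apply, Pi.smul_apply, smul_eq_mul]
    ring
  rw [map_add, map_smul, Pi.add_apply, Pi.smul_apply, smul_eq_mul,
    pow_stepOp_const hδ _ _ hX (by omega)] at h2
  have h3 := pow_stepOp_newMean_size_le hδ hX hX0 (by omega) j hc hK
  have h4 := mul_le_mul_of_nonneg_left h3 (by positivity : 0 ≤ (R + 1) * (2 * (R + 1)))
  rw [momentBound]
  linarith

/-- The transition operator of the graph. -/
noncomputable def growOp (m : ℕ) (δ : ℝ) : Module.End ℝ (PAMultigraph V → ℝ) where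
  toFun f G := stepMean m δ G fun v l => f (G.attach v l)
  map_add' f f' := by ext G; exact map_add (stepMean m δ G) _ _
  map_smul' c f := by ext G; exact map_smul (stepMean m δ G) c _

lemma pow_stepOp_graph (j : ℕ) (f : PAMultigraph V → ℝ) (X : History V) :
    (stepOp m δ ^ j) (fun Y => f Y.graph) X = (growOp m δ ^ j) f X.graph := by
  induction j generalizing X with
  | zero => rfl
  | succ j ih =>
    rw [pow_succ', pow_succ', Module.End.mul_apply, Module.End.mul_apply]
    exact stepMean_congr fun v _ l _ => ih (X.step v l)

/-- After `j` steps with shift `δ`, one more step with shift `δ'` instead of `δ` changes the mean of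
a bounded function of the graph by `O(1 / √j)` only. -/
theorem Good.pow_growOp_sub_le (hδ : -(m : ℝ) < δ) (hδ' : -(m : ℝ) < δ') {G : PAMultigraph V}
    (hG : Good m G) (hs : G.verts.card = s) {j : ℕ} (hc : s + j < Fintype.card V)
    (hj : j ≤ s) (hK : 2 * (m * (3 * m + δ) / (m + δ)) * j ≤ s) {f : PAMultigraph V → ℝ}
    (hf : ∀ H, Good m H → H.verts.card = s + j + 1 → |f H| ≤ 1) :
    (growOp m δ ^ j) (growOp m δ' f) G
      ≤ (growOp m δ ^ j) (growOp m δ f) G + (momentBound m δ δ' + 1) / √(j + 1 : ℕ) := by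
  have hs2 : 2 ≤ s := hs ▸ hG.two_le
  have hX : Valid m s 0 (⟨G, 0⟩ : History V) := hs ▸ hG.valid
  set X : History V := ⟨G, 0⟩ with hXdef
  set c := normRatio m δ δ' (s + j) with hcdef
  set M := momentBound m δ δ' with hM
  have hM0 : 0 ≤ M := momentBound_nonneg hδ hδ'
  set q : ℝ := √(j + 1 : ℕ) with hq
  have hq0 : 0 < q := Real.sqrt_pos.mpr (by positivity)
  have hqq : q * q = j + 1 := by
    rw [hq, Real.mul_self_sqrt (by positivity)]
    push_cast
    rfl
  set F : History V → Block V → ℝ := fun Y B => score δ δ' c Y.graph B.targets * f Y.graph with hF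
  have h1 : (growOp m δ ^ j) (growOp m δ' f) G - (growOp m δ ^ j) (growOp m δ f) G
      = (stepOp m δ ^ j) (newMean m δ F) X := by
    rw [← Pi.sub_apply, ← map_sub]
    refine (pow_stepOp_graph j _ X).symm.trans (pow_stepOp_congr hδ hX fun Y hY => ?_)
    refine Eq.trans (stepMean_score_mul (δ' := δ') hδ hY.good
      fun v l => f (Y.graph.attach v l)).symm ?_
    rw [hY.card_eq]
    rfl
  have h2 : blockSum F = fun Y => scoreSum δ δ' c Y * f Y.graph := by
    ext Y
    rw [scoreSum, blockSum, blockSum, ← Multiset.sum_map_mul_right]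
    simp only [hF, mul_assoc]
  have h3 := pow_stepOp_blockSum hδ hX rfl j F
  have h4 : (stepOp m δ ^ (j + 1)) (blockSum F) X
      ≤ (stepOp m δ ^ (j + 1)) (q⁻¹ • (fun Y => scoreSum δ δ' c Y ^ 2) + fun _ => q) X := by
    refine pow_stepOp_mono hδ _ hX fun Y hY => ?_
    rw [zero_add] at hY
    have hfY := hf Y.graph hY.good (by rw [hY.card_eq, add_assoc])
    simp only [h2, Pi.add_apply, Pi.smul_apply, smul_eq_mul]
    set y := scoreSum δ δ' c Y
    have h5 : y * f Y.graph ≤ |y| := by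
      refine (le_abs_self _).trans ?_
      rw [abs_mul]
      exact mul_le_of_le_one_right (abs_nonneg _) hfY
    have h6 : |y| ≤ q⁻¹ * y ^ 2 + q := by
      rw [inv_mul_eq_div, div_add' _ _ _ hq0.ne', le_div_iff₀ hq0, ← sq_abs]
      nlinarith [sq_nonneg (|y| - q), abs_nonneg y, mul_nonneg (abs_nonneg y) hq0.le]
    exact h5.trans h6
  rw [map_add, map_smul, Pi.add_apply, Pi.smul_apply, smul_eq_mul,
    pow_stepOp_const hδ _ _ hX (by omega), h3] at h4
  have h5 := pow_stepOp_scoreSum_sq_le hδ hδ' hX rfl hs2 hc hj hK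
  have h6 := mul_le_mul_of_nonneg_left h5 (inv_pos.mpr hq0).le
  rw [← hqq] at h4 h6
  have h7 : q⁻¹ * (q * q * M) = q * M := by field_simp
  have h8 : q * ((stepOp m δ ^ j) (newMean m δ F) X) ≤ M + 1 := by
    refine le_of_mul_le_mul_left ?_ hq0
    rw [h7] at h6
    linarith
  rw [← sub_le_iff_le_add', h1, le_div_iff₀ hq0, mul_comm]
  exact h8

lemma Good.pow_growOp_mem (hδ : -(m : ℝ) < δ) {f : PAMultigraph V → ℝ}
    (hf0 : ∀ H, 0 ≤ f H) (hf1 : ∀ H, f H ≤ 1) (j : ℕ) : ∀ {G : PAMultigraph V}, Good m G →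
    G.verts.card + j ≤ Fintype.card V → 0 ≤ (growOp m δ ^ j) f G ∧ (growOp m δ ^ j) f G ≤ 1 := by
  induction j with
  | zero => intro G _ _; exact ⟨hf0 G, hf1 G⟩
  | succ j ih =>
    intro G hG hc
    have hcard : G.verts.card < Fintype.card V := by omega
    have h : ∀ v ∉ G.verts, ∀ l ∈ lists G.verts m, 0 ≤ (growOp m δ ^ j) f (G.attach v l)
        ∧ (growOp m δ ^ j) f (G.attach v l) ≤ 1 := fun v hv l hl => by
      refine ih (hG.attach hv hl) ?_
      rw [PAMultigraph.attach, Finset.card_insert_of_notMem hv]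
      omega
    rw [pow_succ', Module.End.mul_apply]
    constructor
    · refine (stepMean_const hδ hG hcard 0).symm.trans_le ?_
      exact stepMean_mono hδ hG fun v hv l hl => (h v hv l hl).1
    · refine le_trans ?_ (stepMean_const hδ hG hcard 1).le
      exact stepMean_mono hδ hG fun v hv l hl => (h v hv l hl).2

end LateStep

/-! ### The laws of the model -/

section Laws

open scoped ENNReal

/-- The mean of a nonnegative function under a discrete distribution. -/
noncomputable def pmean {α : Type*} (p : PMF α) (F : α → ℝ≥0∞) : ℝ≥0∞ := ∑' a, p a * F a

lemma pmean_bind {α β : Type*} (p : PMF α) (q : α → PMF β) (F : β → ℝ≥0∞) :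
    pmean (p.bind q) F = pmean p fun a => pmean (q a) F := by
  simp only [pmean, PMF.bind_apply, ← ENNReal.tsum_mul_right, ← ENNReal.tsum_mul_left]
  rw [ENNReal.tsum_comm]
  simp only [mul_assoc]

lemma pmean_pure {α : Type*} (a : α) (F : α → ℝ≥0∞) : pmean (PMF.pure a) F = F a := by
  rw [pmean, tsum_eq_single a fun b hb => by simp [hb]]
  simp

lemma pmean_map {α β : Type*} (p : PMF α) (g : α → β) (F : β → ℝ≥0∞) :
    pmean (p.map g) F = pmean p fun a => F (g a) := by
  rw [PMF.map, pmean_bind]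
  simp only [Function.comp_apply, pmean_pure]

lemma pmean_add_const {α : Type*} (p : PMF α) (F : α → ℝ≥0∞) (c : ℝ≥0∞) :
    pmean p (fun a => F a + c) = pmean p F + c := by
  simp only [pmean, mul_add]
  rw [ENNReal.tsum_add, ENNReal.tsum_mul_right, p.tsum_coe, one_mul]

lemma pmean_uniformOfFinset {α : Type*} {S : Finset α} (hS : S.Nonempty) (F : α → ℝ≥0∞) :
    pmean (PMF.uniformOfFinset S hS) F = ∑ a ∈ S, (S.card : ℝ≥0∞)⁻¹ * F a := by
  rw [pmean, tsum_eq_sum (s := S) fun a ha => by simp [ha]]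
  exact Finset.sum_congr rfl fun a ha => by simp [ha]

open Classical in
lemma pmean_weightedOn {α : Type*} {S : Finset α} {w : α → ℝ} (hw : ∀ a ∈ S, 0 ≤ w a)
    (hS : 0 < ∑ a ∈ S, w a) (d : α) (F : α → ℝ≥0∞) :
    pmean (weightedOn S w d) F = ∑ a ∈ S, ENNReal.ofReal (w a / ∑ b ∈ S, w b) * F a := by
  have h : ∃ a ∈ S, 0 < w a := by
    by_contra! h
    exact absurd hS (Finset.sum_nonpos h).not_gt
  have h1 : ∑' a, (if a ∈ S then ENNReal.ofReal (w a) else 0)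
      = ENNReal.ofReal (∑ b ∈ S, w b) := by
    rw [tsum_eq_sum (s := S) fun a ha => if_neg ha, ENNReal.ofReal_sum_of_nonneg hw]
    exact Finset.sum_congr rfl fun a ha => if_pos ha
  rw [pmean, tsum_eq_sum (s := S) fun a ha => ?_]
  · refine Finset.sum_congr rfl fun a ha => ?_
    rw [weightedOn, dif_pos h, PMF.normalize_apply, if_pos ha, ENNReal.ofReal_div_of_pos hS,
      div_eq_mul_inv]
    congr 3
  · rw [weightedOn, dif_pos h, PMF.normalize_apply, if_neg ha, zero_mul, zero_mul]

variable {V : Type*} [DecidableEq V] {m : ℕ} {δ : ℝ} {G : PAMultigraph V}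

lemma Good.pmean_attachEdges (hδ : -(m : ℝ) < δ) (hG : Good m G) {v : V}
    (hv : v ∉ G.verts) (i : ℕ) (F : PAMultigraph V → ℝ≥0∞) :
    pmean (attachEdges δ G.verts v i (G.addVertex v)) F
      = ∑ l ∈ lists G.verts i, ENNReal.ofReal (att (G.shift δ) G.verts i l) * F (G.attach v l) := by
  induction i generalizing F with
  | zero =>
    rw [attachEdges, pmean_pure]
    simp [lists, att, wt, pz, PAMultigraph.attach, PAMultigraph.addVertex]
  | succ i ih =>
    rw [attachEdges, pmean_bind, ih, sum_lists_succ]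
    refine Finset.sum_congr rfl fun l hl => ?_
    have hw : ∀ u ∈ G.verts, ((G.attach v l).deg u : ℝ) + δ = G.shift δ u + l.count u := by
      intro u hu
      rw [deg_attach_of_ne G (fun h => hv (by rwa [← h])), PAMultigraph.shift]
      push_cast
      ring
    have hsum : ∑ u ∈ G.verts, (((G.attach v l).deg u : ℝ) + δ)
        = ∑ u ∈ G.verts, G.shift δ u + i := by
      rw [Finset.sum_congr rfl hw, Finset.sum_add_distrib, sum_count_lists hl]
    have hpos := hG.sum_shift_pos hδ
    rw [pmean_map, pmean_weightedOn (fun u hu => ?_) (by rw [hsum]; positivity), Finset.mul_sum]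
    · refine Finset.sum_congr rfl fun u hu => ?_
      rw [hsum, hw u hu, ← attach_cons, att_cons,
        ENNReal.ofReal_mul (att_nonneg (hG.shift_nonneg hδ) hl), mul_assoc]
    · rw [hw u hu]
      exact add_nonneg (hG.shift_nonneg hδ u hu) (Nat.cast_nonneg _)

lemma good_initial {a b : V} (hab : a ≠ b) :
    Good m (⟨{a, b}, Multiset.replicate m s(a, b)⟩ : PAMultigraph V) := by
  have hdeg : ∀ u, PAMultigraph.deg (⟨{a, b}, Multiset.replicate m s(a, b)⟩ : PAMultigraph V) u
      = if u = a ∨ u = b then m else 0 := by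
    intro u
    simp only [PAMultigraph.deg]
    split_ifs with h
    · rw [Multiset.countP_eq_card.mpr fun e he => ?_, Multiset.card_replicate]
      rw [Multiset.eq_of_mem_replicate he]
      simpa using h
    · rw [Multiset.countP_eq_zero]
      intro e he
      rw [Multiset.eq_of_mem_replicate he]
      simpa using h
  refine ⟨?_, fun u hu => ?_, fun u hu => ?_, ?_⟩
  · exact (Finset.card_pair hab).ge
  · rw [hdeg, if_neg (by simpa using hu)]
  · rw [hdeg, if_pos (by simpa using hu)]
  · simp only [hdeg]
    rw [Finset.sum_pair hab, Finset.card_pair hab]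
    simp
    ring

variable [Fintype V]

lemma Good.pmean_growthStep (hδ : -(m : ℝ) < δ) (hG : Good m G)
    (hc : G.verts.card < Fintype.card V) (F : PAMultigraph V → ℝ≥0∞) :
    pmean (growthStep m δ G) F = ∑ v ∈ G.free, (G.free.card : ℝ≥0∞)⁻¹ *
      ∑ l ∈ lists G.verts m,
        ENNReal.ofReal (att (G.shift δ) G.verts m l) * F (G.attach v l) := by
  have h : G.free.Nonempty := by
    rw [← Finset.card_pos, card_free]
    omega
  rw [growthStep, dif_pos h, pmean_bind, pmean_uniformOfFinset]
  refine Finset.sum_congr rfl fun v hv => ?_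
  rw [hG.pmean_attachEdges hδ (mem_free.mp hv)]

lemma Good.pmean_growthStep_ofReal (hδ : -(m : ℝ) < δ) (hG : Good m G)
    (hc : G.verts.card < Fintype.card V) {f : PAMultigraph V → ℝ}
    (hf : ∀ H, Good m H → H.verts.card = G.verts.card + 1 → 0 ≤ f H) :
    pmean (growthStep m δ G) (fun H => ENNReal.ofReal (f H)) = ENNReal.ofReal (growOp m δ f G) := by
  have hpos : 0 < G.free.card := by
    rw [card_free]
    omega
  have h0 : ∀ v ∈ G.free, ∀ l ∈ lists G.verts m,
      0 ≤ att (G.shift δ) G.verts m l * f (G.attach v l) := fun v hv l hl =>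
    mul_nonneg (att_nonneg (hG.shift_nonneg hδ) hl) (hf _ (hG.attach (mem_free.mp hv) hl)
      (Finset.card_insert_of_notMem (mem_free.mp hv)))
  rw [hG.pmean_growthStep hδ hc]
  have h1 : growOp m δ f G = ∑ v ∈ G.free, (G.free.card : ℝ)⁻¹ *
    ∑ l ∈ lists G.verts m, att (G.shift δ) G.verts m l * f (G.attach v l) := rfl
  rw [h1, ENNReal.ofReal_sum_of_nonneg fun v hv =>
    mul_nonneg (by positivity) (Finset.sum_nonneg (h0 v hv))]
  refine Finset.sum_congr rfl fun v hv => ?_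
  rw [ENNReal.ofReal_mul (by positivity), ENNReal.ofReal_inv_of_pos (by exact_mod_cast hpos),
    ENNReal.ofReal_natCast, ENNReal.ofReal_sum_of_nonneg (h0 v hv)]
  congr 1
  refine Finset.sum_congr rfl fun l hl => ?_
  rw [ENNReal.ofReal_mul (att_nonneg (hG.shift_nonneg hδ) hl)]

variable {d : ℕ → ℝ}

/-- The law at time `t` is carried by the good graphs with `t` vertices. -/
lemma pmean_graphLaw_mono (hd : ∀ t, -(m : ℝ) < d t) {t : ℕ} (ht : 2 ≤ t)
    (htV : t ≤ Fintype.card V) {F F' : PAMultigraph V → ℝ≥0∞}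
    (h : ∀ H, Good m H → H.verts.card = t → F H ≤ F' H) :
    pmean (graphLaw V m d t) F ≤ pmean (graphLaw V m d t) F' := by
  induction t, ht using Nat.le_induction generalizing F F' with
  | base =>
    have hne : ((Finset.univ : Finset V).offDiag).Nonempty := by
      obtain ⟨a, b, hab⟩ := Fintype.exists_pair_of_one_lt_card (α := V) (by omega)
      exact ⟨(a, b), by simpa using hab⟩
    rw [graphLaw, initialLaw, dif_pos hne, pmean_map, pmean_map, pmean_uniformOfFinset,
      pmean_uniformOfFinset]
    · refine Finset.sum_le_sum fun p hp => mul_le_mul_right (h _ (good_initial ?_) ?_) _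
      · exact (Finset.mem_offDiag.mp hp).2.2
      · exact Finset.card_pair (Finset.mem_offDiag.mp hp).2.2
    all_goals simp
  | succ t ht ih =>
    obtain ⟨t, rfl⟩ := Nat.exists_eq_add_of_le' ht
    rw [graphLaw, pmean_bind, pmean_bind]
    refine ih (by omega) fun H hH hcard => ?_
    rw [hH.pmean_growthStep (hd _) (by omega), hH.pmean_growthStep (hd _) (by omega)]
    refine Finset.sum_le_sum fun v hv => mul_le_mul_right (Finset.sum_le_sum fun l hl =>
      mul_le_mul_right (h _ (hH.attach (mem_free.mp hv) hl) ?_) _) _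
    rw [PAMultigraph.attach, Finset.card_insert_of_notMem (mem_free.mp hv), hcard]

lemma pmean_graphLaw_congr (hd : ∀ t, -(m : ℝ) < d t) {t : ℕ} (ht : 2 ≤ t)
    (htV : t ≤ Fintype.card V) {F F' : PAMultigraph V → ℝ≥0∞}
    (h : ∀ H, Good m H → H.verts.card = t → F H = F' H) :
    pmean (graphLaw V m d t) F = pmean (graphLaw V m d t) F' :=
  le_antisymm (pmean_graphLaw_mono hd ht htV fun H hH hc => (h H hH hc).le)
    (pmean_graphLaw_mono hd ht htV fun H hH hc => (h H hH hc).ge)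

lemma pmean_graphLaw_succ (hd : ∀ t, -(m : ℝ) < d t) {t : ℕ} (ht : 2 ≤ t)
    (htV : t < Fintype.card V) {f : PAMultigraph V → ℝ}
    (hf : ∀ H, Good m H → H.verts.card = t + 1 → 0 ≤ f H) :
    pmean (graphLaw V m d (t + 1)) (fun H => ENNReal.ofReal (f H))
      = pmean (graphLaw V m d t) (fun H => ENNReal.ofReal (growOp m (d (t + 1)) f H)) := by
  obtain ⟨t, rfl⟩ := Nat.exists_eq_add_of_le' ht
  rw [graphLaw, pmean_bind]
  refine pmean_graphLaw_congr hd ht htV.le fun H hH hc => ?_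
  exact hH.pmean_growthStep_ofReal (hd _) (by omega) fun K hK hKc => hf K hK (by omega)

lemma growOp_nonneg (hδ : -(m : ℝ) < δ) (hG : Good m G) {f : PAMultigraph V → ℝ}
    (hf : ∀ H, Good m H → H.verts.card = G.verts.card + 1 → 0 ≤ f H) : 0 ≤ growOp m δ f G := by
  refine (map_zero (stepMean m δ G)).symm.trans_le (stepMean_mono hδ hG fun v hv l hl => ?_)
  exact hf _ (hG.attach hv hl) (Finset.card_insert_of_notMem hv)

lemma pmean_graphLaw_add (hd : ∀ t, -(m : ℝ) < d t) {t : ℕ} (ht : 2 ≤ t) (j : ℕ)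
    (htV : t + j ≤ Fintype.card V) (hδ : ∀ i, t < i → i ≤ t + j → d i = δ) {f : PAMultigraph V → ℝ}
    (hf : ∀ H, Good m H → H.verts.card = t + j → 0 ≤ f H) :
    pmean (graphLaw V m d (t + j)) (fun H => ENNReal.ofReal (f H))
      = pmean (graphLaw V m d t) (fun H => ENNReal.ofReal ((growOp m δ ^ j) f H)) := by
  induction j generalizing f with
  | zero => rfl
  | succ j ih =>
    rw [← add_assoc, pmean_graphLaw_succ hd (t := t + j) (by omega) (by omega) hf,
      hδ _ (by omega) (by omega), ih (by omega) fun i hi hi' => hδ i hi (by omega), pow_succ]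
    · rfl
    · intro H hH hc
      rw [← hδ (t + j + 1) (by omega) (by omega)]
      exact growOp_nonneg (hd _) hH fun K hK hKc => hf K hK (by omega)

lemma graphLaw_congr {d' : ℕ → ℝ} {t : ℕ} (h : ∀ i ≤ t, d i = d' i) :
    graphLaw V m d t = graphLaw V m d' t := by
  induction t using graphLaw.induct with
  | case1 t ih =>
    rw [graphLaw, graphLaw, ih fun i hi => h i (by omega), h _ le_rfl]
  | case2 t ht =>
    match t, ht with
    | 0, _ => rfl
    | 1, _ => rfl
    | 2, _ => rfl
    | t + 3, ht => exact absurd rfl (ht t)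

end Laws

/-! ### Changepoints -/

section Changepoint

open scoped ENNReal

lemma toMeasure_real_eq {V : Type*} (p : PMF (PAMultigraph V)) (A : Set (PAMultigraph V)) :
    p.toMeasure.real A
      = (pmean p fun G => ENNReal.ofReal (A.indicator (fun _ => (1 : ℝ)) G)).toReal := by
  rw [MeasureTheory.measureReal_def, p.toMeasure_apply MeasurableSpace.measurableSet_top, pmean]
  congr 1
  refine tsum_congr fun G => ?_
  by_cases h : G ∈ A <;> simp [h]

/-- The sequence of shifts with a change after time `τ`. -/
noncomputable def shiftSeq (δ δ' : ℝ) (τ t : ℕ) : ℝ := if t ≤ τ then δ else δ'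

variable {m n : ℕ} {δ δ' : ℝ}

lemma changepointLaw_eq (τ : ℕ) :
    changepointLaw m n δ δ' τ = graphLaw (Fin n) m (shiftSeq δ δ' τ) n := rfl

/-- The law of the snapshot seen from an earlier time `s`: `k` steps with shift `δ` lead to the
changepoint, and the remaining ones use `δ'`. -/
lemma pmean_changepointLaw (hδ : -(m : ℝ) < δ) (hδ' : -(m : ℝ) < δ') {s k τ : ℕ} (hs : 2 ≤ s)
    (hτ : τ = s + k) (hn : τ ≤ n) {f : PAMultigraph (Fin n) → ℝ} (hf0 : ∀ H, 0 ≤ f H)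
    (hf1 : ∀ H, f H ≤ 1) :
    pmean (changepointLaw m n δ δ' τ) (fun H => ENNReal.ofReal (f H))
      = pmean (graphLaw (Fin n) m (fun _ => δ) s) (fun H => ENNReal.ofReal
          ((growOp m δ ^ k) ((growOp m δ' ^ (n - τ)) f) H)) := by
  have hd : ∀ t, -(m : ℝ) < shiftSeq δ δ' τ t := fun t => by
    rw [shiftSeq]
    split_ifs <;> assumption
  rw [changepointLaw_eq]
  have h1 := pmean_graphLaw_add (V := Fin n) hd (t := τ) (by omega) (n - τ) (δ := δ')
    (by rw [Fintype.card_fin]; omega) (fun i hi _ => if_neg (by omega)) (f := f)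
    (fun H _ _ => hf0 H)
  rw [Nat.add_sub_cancel' hn] at h1
  rw [h1, graphLaw_congr (d := shiftSeq δ δ' τ) (d' := fun _ => δ) fun i hi => if_pos hi]
  subst hτ
  refine pmean_graphLaw_add (fun _ => hδ) hs k (by rw [Fintype.card_fin]; omega)
    (fun _ _ _ => rfl) fun H hH hc => ?_
  exact (hH.pow_growOp_mem hδ' hf0 hf1 _ (by rw [Fintype.card_fin]; omega)).1

/-- Moving a late changepoint by one step changes the probability of an event by `O(1 / √j)`, if
there are `j` earlier vertices among which the vertex of the changed step is hidden. -/
lemma changepointLaw_pred_le (hδ : -(m : ℝ) < δ) (hδ' : -(m : ℝ) < δ') {s j : ℕ} (hs : 2 ≤ s)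
    (hn : s + j + 1 ≤ n) (hj : j ≤ s) (hK : 2 * (m * (3 * m + δ) / (m + δ)) * j ≤ s)
    (A : Set (PAMultigraph (Fin n))) :
    (changepointLaw m n δ δ' (s + j)).toMeasure.real A
      ≤ (changepointLaw m n δ δ' (s + j + 1)).toMeasure.real A
        + (momentBound m δ δ' + 1) / √(j + 1 : ℕ) := by
  set f : PAMultigraph (Fin n) → ℝ := A.indicator fun _ => (1 : ℝ) with hf
  have hf0 : ∀ H, 0 ≤ f H := fun H => Set.indicator_nonneg (fun _ _ => zero_le_one) H
  have hf1 : ∀ H, f H ≤ 1 := fun H => Set.indicator_le_self' (fun _ _ => zero_le_one) H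
  set g : PAMultigraph (Fin n) → ℝ := (growOp m δ' ^ (n - (s + j + 1))) f with hg
  have hg1 : ∀ H, Good m H → H.verts.card = s + j + 1 → 0 ≤ g H ∧ g H ≤ 1 := fun H hH hc =>
    hH.pow_growOp_mem hδ' hf0 hf1 _ (by rw [Fintype.card_fin]; omega)
  set E := (momentBound m δ δ' + 1) / √(j + 1 : ℕ) with hE
  have hE0 : 0 ≤ E := by
    have := momentBound_nonneg hδ hδ'
    positivity
  have h1 := pmean_changepointLaw (n := n) hδ hδ' hs (k := j) rfl (by omega) hf0 hf1
  have h2 := pmean_changepointLaw (n := n) hδ hδ' hs (k := j + 1) rfl (by omega) hf0 hf1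
  have h3 : n - (s + j) = (n - (s + j + 1)) + 1 := by omega
  rw [h3, pow_succ', Module.End.mul_apply, ← hg] at h1
  rw [← add_assoc, ← hg, pow_succ, Module.End.mul_apply] at h2
  have h4 : pmean (changepointLaw m n δ δ' (s + j)) (fun H => ENNReal.ofReal (f H))
      ≤ pmean (changepointLaw m n δ δ' (s + j + 1)) (fun H => ENNReal.ofReal (f H))
        + ENNReal.ofReal E := by
    rw [h1, h2, ← pmean_add_const]
    refine pmean_graphLaw_mono (fun _ => hδ) hs (by rw [Fintype.card_fin]; omega)
      fun H hH hc => ?_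
    refine le_trans (ENNReal.ofReal_le_ofReal ?_) ENNReal.ofReal_add_le
    refine hH.pow_growOp_sub_le hδ hδ' hc (by rw [Fintype.card_fin]; omega) hj hK fun K hK hKc => ?_
    rw [abs_of_nonneg (hg1 K hK hKc).1]
    exact (hg1 K hK hKc).2
  have hfin : pmean (changepointLaw m n δ δ' (s + j + 1)) (fun H => ENNReal.ofReal (f H)) ≠ ∞ := by
    refine ne_top_of_le_ne_top ENNReal.one_ne_top ?_
    refine (ENNReal.tsum_le_tsum fun H => mul_le_mul_right
      (ENNReal.ofReal_le_one.mpr (hf1 H)) _).trans_eq ?_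
    simp only [mul_one]
    exact PMF.tsum_coe _
  have h5 := ENNReal.toReal_mono (ENNReal.add_ne_top.mpr ⟨hfin, ENNReal.ofReal_ne_top⟩) h4
  rw [ENNReal.toReal_add hfin ENNReal.ofReal_ne_top, ENNReal.toReal_ofReal hE0] at h5
  rwa [toMeasure_real_eq, toMeasure_real_eq]

/-- Late changepoints at a distance `o(√n)` from the end cannot be distinguished from no change. -/
lemma exists_changepointLaw_le (hδ : -(m : ℝ) < δ) (hδ' : -(m : ℝ) < δ') :
    ∃ C : ℝ, 0 ≤ C ∧ ∀ᶠ n : ℕ in atTop, ∀ i : ℕ, 2 * i ≤ n → ∀ A : Set (PAMultigraph (Fin n)),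
      (changepointLaw m n δ δ' (n - i)).toMeasure.real A
        ≤ (changepointLaw m n δ δ' n).toMeasure.real A + i * (C / √n) := by
  have hα : 0 < m + δ := by linarith
  set K := m * (3 * m + δ) / (m + δ) with hK
  have hK0 : 0 ≤ K := by
    have : 0 ≤ 3 * m + δ := by linarith [(Nat.cast_nonneg m : (0 : ℝ) ≤ m)]
    positivity
  -- The window of the `⌊η n⌋` vertices before the changepoint is short enough for the size bound.
  set η : ℝ := 1 / (4 + 8 * K) with hη
  have hη0 : 0 < η := by positivity
  have hη1 : η * (4 + 8 * K) = 1 := by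
    rw [hη]
    field_simp
  set M := momentBound m δ δ' + 1 with hM
  have hM0 : 0 ≤ M := by
    have := momentBound_nonneg hδ hδ'
    positivity
  refine ⟨M / √η, by positivity, ?_⟩
  filter_upwards [eventually_ge_atTop 16] with n hn i hi A
  have hn' : (16 : ℝ) ≤ n := by exact_mod_cast hn
  set j := ⌊η * n⌋₊ with hj
  have hjle : (j : ℝ) ≤ η * n := Nat.floor_le (by positivity)
  have hjlt : η * n < (j + 1 : ℕ) := by
    push_cast
    exact Nat.lt_floor_add_one _
  have hK' : 0 ≤ η * K := by positivity
  have hj4 : 4 * (j : ℝ) ≤ n := by nlinarith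
  have hj4' : 4 * j ≤ n := by exact_mod_cast hj4
  have hroot : M / √(j + 1 : ℕ) ≤ M / √η / √n := by
    rw [div_div, ← Real.sqrt_mul hη0.le]
    gcongr
  induction i with
  | zero => simp
  | succ i ih =>
    have h1 := ih (by omega)
    obtain ⟨s, hs⟩ : ∃ s, n - i = s + j + 1 := ⟨n - i - j - 1, by omega⟩
    have h2 : n - (i + 1) = s + j := by omega
    have hs4 : n ≤ 4 * s := by omega
    have h8 : 2 * K * j ≤ s := by
      have h9 : (n : ℝ) ≤ 4 * s := by exact_mod_cast hs4
      have h10 : K * j ≤ K * (η * n) := by gcongr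
      have h11 : 8 * (η * K) * n ≤ 1 * n := by
        gcongr
        linarith
      linarith
    have h3 := changepointLaw_pred_le (n := n) (δ := δ) (δ' := δ') (s := s) (j := j) hδ hδ'
      (by omega) (by omega) (by omega) h8 A
    rw [h2]
    rw [hs] at h1
    push_cast at h1 ⊢
    linarith

end Changepoint

end PrefAttach

theorem theorem2 (m : ℕ) (hm : 1 ≤ m) (δ δ' : ℝ) (hδ : -(m : ℝ) < δ) (hδ' : -(m : ℝ) < δ')
    (hne : δ ≠ δ') (ε : ℝ) (hε₀ : 0 < ε) (hε₁ : ε < 1)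
    (T : (n : ℕ) → PrefAttach.PAMultigraph (Fin n) → ℝ)
    (r : ℕ → ℝ) (hr : r =o[atTop] fun n : ℕ => √(n : ℝ))
    (c : ℝ) (hc : 0 < c) :
    ∀ᶠ n : ℕ in atTop, ∃ τ : ℕ, ε * n ≤ τ ∧ τ ≤ n ∧
      (PrefAttach.changepointLaw m n δ δ' τ).toMeasure.real {G | |T n G - τ| ≤ r n} < c := by
  obtain ⟨C, hC0, hC⟩ := PrefAttach.exists_changepointLaw_le hδ hδ'
  obtain ⟨N, hN⟩ := exists_nat_one_div_lt (half_pos hc)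
  -- `N + 1` candidates at mutual distance `d n > 2 r n`, so that the events are disjoint.
  set d : ℕ → ℕ := fun n => ⌊2 * r n⌋₊ + 1 with hd
  have hdle : ∀ n, (d n : ℝ) ≤ 2 * |r n| + 1 := fun n => by
    have h1 : (⌊2 * r n⌋₊ : ℝ) ≤ ⌊2 * |r n|⌋₊ := by
      exact_mod_cast Nat.floor_mono (by linarith [le_abs_self (r n)])
    have h2 : (⌊2 * |r n|⌋₊ : ℝ) ≤ 2 * |r n| := Nat.floor_le (by positivity)
    simp only [hd]
    push_cast
    linarith
  have hsqrt : Tendsto (fun n : ℕ => √(n : ℝ)) atTop atTop :=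
    Real.tendsto_sqrt_atTop.comp tendsto_natCast_atTop_atTop
  have hdo : (fun n => (d n : ℝ)) =o[atTop] fun n : ℕ => √(n : ℝ) := by
    have h1 : (fun n => 2 * |r n| + 1) =o[atTop] fun n : ℕ => √(n : ℝ) :=
      (hr.abs_left.const_mul_left 2).add (isLittleO_const_left.mpr
        (Or.inr (tendsto_abs_atTop_atTop.comp hsqrt)))
    refine IsBigO.trans_isLittleO (IsBigO.of_bound 1 (Eventually.of_forall fun n => ?_)) h1
    rw [one_mul, Real.norm_eq_abs, Real.norm_eq_abs, Nat.abs_cast]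
    exact (hdle n).trans (le_abs_self _)
  set κ : ℝ := min ((c / 2) / ((N + 1) * (C + 1))) (min (1 / 2) (1 - ε) / (N + 1)) with hκ
  have hκ0 : 0 < κ := by
    have h1 : 0 < min (1 / 2) (1 - ε) := lt_min (by norm_num) (by linarith)
    exact lt_min (by positivity) (by positivity)
  filter_upwards [hC, hdo.bound hκ0, eventually_ge_atTop 1] with n hCn hdn hn1
  have hn1' : (1 : ℝ) ≤ n := by exact_mod_cast hn1
  have hsq0 : 0 < √(n : ℝ) := Real.sqrt_pos.mpr (by linarith)
  rw [Real.norm_eq_abs, Real.norm_eq_abs, Nat.abs_cast, abs_of_pos hsq0] at hdn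
  have hsqn : √(n : ℝ) ≤ n := by
    rw [Real.sqrt_le_left (by linarith)]
    nlinarith
  have hN0 : (0 : ℝ) < N + 1 := by positivity
  have hfar : ((N : ℝ) + 1) * d n ≤ min (1 / 2) (1 - ε) * n := by
    have h1 : (d n : ℝ) ≤ min (1 / 2) (1 - ε) / (N + 1) * n :=
      hdn.trans (mul_le_mul (min_le_right _ _) hsqn hsq0.le (hκ0.le.trans (min_le_right _ _)))
    calc ((N : ℝ) + 1) * d n ≤ (N + 1) * (min (1 / 2) (1 - ε) / (N + 1) * n) := by gcongr
      _ = _ := by field_simp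
  have hloss : ((N : ℝ) + 1) * d n * (C / √n) ≤ c / 2 := by
    have h1 : (d n : ℝ) ≤ (c / 2) / ((N + 1) * (C + 1)) * √n :=
      hdn.trans (mul_le_mul_of_nonneg_right (min_le_left _ _) hsq0.le)
    calc ((N : ℝ) + 1) * d n * (C / √n)
        ≤ (N + 1) * ((c / 2) / ((N + 1) * (C + 1)) * √n) * (C / √n) := by gcongr
      _ = (c / 2) * (C / (C + 1)) := by field_simp
      _ ≤ (c / 2) * 1 := by
          gcongr
          rw [div_le_one (by positivity)]
          linarith
      _ = c / 2 := mul_one _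
  have hhalf : 2 * ((N + 1) * d n) ≤ n := by
    have h1 : min (1 / 2) (1 - ε) * (n : ℝ) ≤ 1 / 2 * n := by
      gcongr
      exact min_le_left _ _
    have h2 : 2 * (((N : ℝ) + 1) * d n) ≤ n := by linarith
    exact_mod_cast h2
  have hle : ∀ i ∈ Finset.range (N + 1), i * d n ≤ (N + 1) * d n := fun i hi =>
    Nat.mul_le_mul_right _ (Finset.mem_range.mp hi).le
  set A : ℕ → Set (PrefAttach.PAMultigraph (Fin n)) :=
    fun i => {G | |T n G - (n - i * d n : ℕ)| ≤ r n} with hA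
  have hdisj : (Finset.range (N + 1) : Set ℕ).PairwiseDisjoint A := by
    have key : ∀ i ∈ Finset.range (N + 1), ∀ k ∈ Finset.range (N + 1), i < k →
        Disjoint (A i) (A k) := by
      intro i hi k hk hik
      rw [Set.disjoint_left]
      intro G hGi hGk
      have h1 := hle i hi
      have h2 := hle k hk
      simp only [hA, Set.mem_ofPred_eq] at hGi hGk
      rw [Nat.cast_sub (by omega)] at hGi hGk
      push_cast at hGi hGk
      have h3 : (2 * r n) < d n := by
        simp only [hd]
        push_cast
        exact Nat.lt_floor_add_one _
      have h4 : (i : ℝ) + 1 ≤ k := by exact_mod_cast hik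
      have h5 : (d n : ℝ) ≤ (k - i) * d n := le_mul_of_one_le_left (Nat.cast_nonneg _) (by linarith)
      have h6 := (abs_le.mp hGi).1
      have h7 := (abs_le.mp hGk).2
      linarith
    intro i hi k hk hik
    rcases Nat.lt_or_gt_of_ne hik with h | h
    · exact key i hi k hk h
    · exact (key k hk i hi h).symm
  set P := (PrefAttach.changepointLaw m n δ δ' n).toMeasure with hP
  have hsum : ∑ i ∈ Finset.range (N + 1), P.real (A i) ≤ ((N + 1 : ℕ) : ℝ) * (1 / (N + 1)) := by
    rw [← MeasureTheory.measureReal_biUnion_finset hdisj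
      fun _ _ => MeasurableSpace.measurableSet_top]
    push_cast
    rw [mul_one_div_cancel hN0.ne']
    exact MeasureTheory.measureReal_le_one
  obtain ⟨i, hi, hPi⟩ : ∃ i ∈ Finset.range (N + 1), P.real (A i) ≤ 1 / (N + 1) := by
    refine Finset.exists_le_of_sum_le ⟨0, by simp⟩ (hsum.trans_eq ?_)
    rw [Finset.sum_const, Finset.card_range, nsmul_eq_mul]
  have hi' := hle i hi
  have hiR : ((i * d n : ℕ) : ℝ) ≤ (N + 1) * d n := by exact_mod_cast hi'
  refine ⟨n - i * d n, ?_, Nat.sub_le _ _, ?_⟩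
  · rw [Nat.cast_sub (by omega)]
    have h1 : min (1 / 2) (1 - ε) * (n : ℝ) ≤ (1 - ε) * n := by
      gcongr
      exact min_le_right _ _
    linarith
  · have h1 := hCn (i * d n) (by omega) (A i)
    have h2 : ((i * d n : ℕ) : ℝ) * (C / √n) ≤ (N + 1) * d n * (C / √n) := by gcongr
    exact h1.trans_lt (by linarith)
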